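/- Let $d,m\ge 1$ be integers and $n=d+m$. Write $|\cdot|$ for the supremum norm of a real vector and $\|\bm y\|=\min_{\bm k\in\mathbb Z^k}|\bm y-\bm k|$ for the supremum-norm distance from $\bm y\in\mathbb R^k$ to the nearest integer vector. For a real $k\times l$ matrix $B$, let $\omega(B)\in[-\infty,\infty]$ be the supremum of all $w\in\mathbb R$ such that $\|B\bm q^{\mathrm T}\|<|\bm q|^{-w}$ for infinitely many $\bm q\in\mathbb Z^{l}$, and put $\sigma(B)=\omega(B^{\mathrm T})$. Let $A\in\mathbb R^{(d+1)\times m}$ and let $$\mathcal L=\{(\bm x,\widetilde{\bm x}A):\bm x\in\mathbb R^d\}\subset\mathbb R^n,\qquad \widetilde{\bm x}=(1,\bm x),$$ be the $d$-dimensional affine subspace parametrized by $A$, with induced ($d$-dimensional) Lebesgue measure $|\cdot|_{\mathcal L}$. For $\tau\in\mathbb R$ and $\bm\theta\in\mathbb R^n$ let $$\mathcal S_n(\tau,\bm\theta)=\{\bm y\in\mathbb R^n:\ \|q\bm y-\bm\theta\|<q^{-\tau}\text{ for infinitely many integers } q\ge 1\},$$ and $$\sigma(\mathcal L,\bm\theta)=\sup\{\tau\in\mathbb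 R:\ |\mathcal S_n(\tau,\bm\theta)\cap\mathcal L|_{\mathcal L}>0\}.$$ Then for every $\bm\theta\in\mathbb R^n$, $$\sigma(\mathcal L,\bm\theta)\le\min\left\{\frac1d\left(1-\frac{m}{\max\{n,\omega(A)\}}\right),\ \frac{m\,\sigma(A)-d}{n}\right\},$$ where $m/\infty=0$ and $(m\cdot\infty-d)/n=\infty$. Moreover, $$\omega(A)\le n\iff\sigma(\mathcal L,\bm\theta)=\frac1n\ \text{ for all }\bm\theta\in\mathbb R^n .$$ -/

import Mathlib

open MeasureTheory
open scoped Matrix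

noncomputable section

/-- The `ℓ^∞` distance `‖y‖` from a real vector `y` to the nearest integer vector.
The norm on `ι → ℝ` is the supremum norm. -/
def nearestIntDist {ι : Type*} [Fintype ι] (y : ι → ℝ) : ℝ :=
  ⨅ k : ι → ℤ, ‖y - fun i => (k i : ℝ)‖

/-- The diophantine exponent `ω(A)`: the supremum, in the extended reals, of the real numbers `w`
such that `‖A qᵀ‖ < |q|^{-w}` for infinitely many integer vectors `q`. -/
def diophantineExponent {ι κ : Type*} [Fintype ι] [Fintype κ] (A : Matrix ι κ ℝ) : EReal :=
  sSup ((fun w : ℝ => (w : EReal)) ''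
    {w : ℝ | {q : κ → ℤ |
      nearestIntDist (A *ᵥ fun j => (q j : ℝ)) < ‖fun j => (q j : ℝ)‖ ^ (-w)}.Infinite})

/-- The exponent `σ(A) = ω(Aᵀ)`. -/
def dualDiophantineExponent {ι κ : Type*} [Fintype ι] [Fintype κ] (A : Matrix ι κ ℝ) : EReal :=
  diophantineExponent Aᵀ

/-- The set `S_n(ψ, θ)` of inhomogeneously `ψ`-approximable points of `ℝⁿ`: those `y` with
`‖q y - θ‖ < ψ(q)` for infinitely many positive integers `q`. -/
def approximableSet {n : ℕ} (ψ : ℕ → ℝ) (θ : EuclideanSpace ℝ (Fin n)) :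
    Set (EuclideanSpace ℝ (Fin n)) :=
  {y | {q : ℕ | 0 < q ∧ nearestIntDist (fun i => (q : ℝ) * y i - θ i) < ψ q}.Infinite}

/-- The set `S_n(τ, θ)`, which is `S_n(ψ, θ)` for `ψ(q) = q^{-τ}`. -/
def powerApproximableSet {n : ℕ} (τ : ℝ) (θ : EuclideanSpace ℝ (Fin n)) :
    Set (EuclideanSpace ℝ (Fin n)) :=
  approximableSet (fun q => (q : ℝ) ^ (-τ)) θ

/-- The induced Lebesgue measure on a `d`-dimensional submanifold `M` of `ℝⁿ`: the `d`-dimensional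
Hausdorff measure of Euclidean `ℝⁿ`, normalized to agree with Lebesgue measure in dimension `d`,
restricted to `M`. -/
def inducedLebesgue {n : ℕ} (d : ℕ) (M : Set (EuclideanSpace ℝ (Fin n))) :
    Measure (EuclideanSpace ℝ (Fin n)) :=
  (μHE[d]).restrict M

/-- The inhomogeneous exponent `σ(M, θ)` of a `d`-dimensional submanifold `M` of `ℝⁿ`: the supremum,
in the extended reals, of the real `τ` such that `S_n(τ, θ) ∩ M` has positive measure in `M`. -/
def inhomogeneousExponent {n : ℕ} (d : ℕ) (M : Set (EuclideanSpace ℝ (Fin n)))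
    (θ : EuclideanSpace ℝ (Fin n)) : EReal :=
  sSup ((fun τ : ℝ => (τ : EReal)) ''
    {τ : ℝ | 0 < inducedLebesgue d M (powerApproximableSet τ θ ∩ M)})

/-- The affine subspace `L_A = {(x, x̃ A) | x ∈ ℝᵈ}` of `ℝ^{d+m}`, where `x̃ = (1, x)`. -/
def affineSubspaceOfMatrix {d m : ℕ} (A : Matrix (Fin (d + 1)) (Fin m) ℝ) :
    Set (EuclideanSpace ℝ (Fin (d + m))) :=
  Set.range fun x : Fin d → ℝ =>
    WithLp.toLp 2 (Fin.append x ((Fin.cons 1 x : Fin (d + 1) → ℝ) ᵥ* A))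

end

/-!
Write `φ(x) = (x, x̃ A)` for the parametrization of the affine subspace; it is bi-Lipschitz, so null
sets may be tested in the parameter space `ℝᵈ` (`inducedLebesgue_inter_eq_zero_iff`).

**Upper bounds.** If `q φ(x)` is within `q^{-τ}` of `θ` modulo integer vectors, then `x` lies within
`q^{-τ-1}` of a point `(p + θ') / q`, and `v = (q, p)` is an integer vector for which `vA` is within
`O(q^{-τ})` of a fixed translate of the integer vectors. By Borel–Cantelli over dyadic ranges of `q`,
almost no `x` has infinitely many such `q` as soon as the number of admissible `v` of size at most
`Q` is `O(Q^s)` with `s < d (τ + 1)` (`volume_preimage_powerApproximableSet_eq_zero`). The two terms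
of the minimum come from two ways of counting the `v`.

* If `‖A h‖ ≫ |h|^{-w}` for all integer `h ≠ 0`, Fourier analysis with frequencies
  `|h| < H = Q^{1/w'}`, `w' > w`, shows that the number of `v` with `vA` within `1 / H` of the
  translate is `O(Q^{d+1} H^{-m})` (`card_nearestIntDist_vecMul_add_le`): the sum over `v` is
  averaged over cubes so often that every nonzero frequency is negligible.
* If `‖vA‖ ≫ |v|^{-w}` for all integer `v ≠ 0`, the points `vA` are separated modulo integer
  vectors, and the pigeonhole principle bounds their number (`card_le_of_separated`).

**The criterion.** If `ω(A) ≤ n`, the first bound is `1 / n`. Applied with `θ = 0` it says that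
almost every point of the subspace is not very well approximable, and for such a point the
inhomogeneous approximation property holds for all `θ` and all exponents below `1 / n`
(`mem_powerApproximableSet_of_not_very_well_approximable`). The underlying transference is that a
lattice without short vectors has no large holes: the segment from a point far from the lattice to an
almost nearest lattice point would contain too many points separated modulo the lattice
(`exists_inhomogeneous_approx`). If `ω(A) > n`, every point of the subspace is unusually close to
rational hyperplanes, and a Khintchine transference
(`mem_powerApproximableSet_zero_of_small_forms`) makes every point approximable with one exponent
above `1 / n` for `θ = 0`.
-/

/-! ### Distance to the integers and diophantine exponents -/

theorem nearestIntDist_le_norm_sub {ι : Type*} [Fintype ι] (y : ι → ℝ) (k : ι → ℤ) :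
    nearestIntDist y ≤ ‖y - fun i => (k i : ℝ)‖ :=
  ciInf_le ⟨0, by rintro _ ⟨k, rfl⟩; exact norm_nonneg _⟩ k

/-- Rounding every coordinate attains the infimum defining `nearestIntDist`. -/
theorem nearestIntDist_eq_norm_sub_round {ι : Type*} [Fintype ι] (y : ι → ℝ) :
    nearestIntDist y = ‖y - fun i => (round (y i) : ℝ)‖ := by
  refine le_antisymm (nearestIntDist_le_norm_sub _ _) (le_ciInf fun k => ?_)
  refine (pi_norm_le_iff_of_nonneg (norm_nonneg _)).2 fun i => ?_
  exact (round_le (y i) (k i)).trans (norm_le_pi_norm (y - fun i => (k i : ℝ)) i)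

theorem nearestIntDist_nonneg {ι : Type*} [Fintype ι] (y : ι → ℝ) : 0 ≤ nearestIntDist y := by
  rw [nearestIntDist_eq_norm_sub_round]; exact norm_nonneg _

theorem abs_sub_round_le_nearestIntDist {ι : Type*} [Fintype ι] (y : ι → ℝ) (i : ι) :
    |y i - round (y i)| ≤ nearestIntDist y := by
  rw [nearestIntDist_eq_norm_sub_round]
  exact norm_le_pi_norm (y - fun i => (round (y i) : ℝ)) i

theorem nearestIntDist_le_half {ι : Type*} [Fintype ι] (y : ι → ℝ) : nearestIntDist y ≤ 1 / 2 := by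
  rw [nearestIntDist_eq_norm_sub_round]
  exact (pi_norm_le_iff_of_nonneg (by norm_num)).2 fun i => abs_sub_round (y i)

theorem nearestIntDist_le_of_forall {ι : Type*} [Fintype ι] {y : ι → ℝ} {r : ℝ} (hr : 0 ≤ r)
    (k : ι → ℤ) (h : ∀ i, |y i - k i| ≤ r) : nearestIntDist y ≤ r :=
  (nearestIntDist_le_norm_sub y k).trans ((pi_norm_le_iff_of_nonneg hr).2 h)

theorem nearestIntDist_lt_of_forall {ι : Type*} [Fintype ι] {y : ι → ℝ} {r : ℝ} (hr : 0 < r)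
    (k : ι → ℤ) (h : ∀ i, |y i - k i| < r) : nearestIntDist y < r :=
  (nearestIntDist_le_norm_sub y k).trans_lt ((pi_norm_lt_iff hr).2 h)

theorem exists_le_abs_sub_round {ι : Type*} [Fintype ι] {y : ι → ℝ} {r : ℝ} (hr : 0 < r)
    (h : r ≤ nearestIntDist y) : ∃ i, r ≤ |y i - round (y i)| := by
  by_contra! hc
  exact absurd (nearestIntDist_lt_of_forall hr _ hc) (not_lt.2 h)

theorem nearestIntDist_natCast_mul_eq_zero {ι : Type*} [Fintype ι] {y : ι → ℝ}
    (h : nearestIntDist y = 0) (k : ℕ) : nearestIntDist (fun i => (k : ℝ) * y i) = 0 := by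
  refine le_antisymm (nearestIntDist_le_of_forall le_rfl (fun i => k * round (y i)) fun i => ?_)
    (nearestIntDist_nonneg _)
  have h0 := abs_sub_round_le_nearestIntDist y i
  rw [h] at h0
  have h1 : y i - round (y i) = 0 := abs_nonpos_iff.1 h0
  have : (k : ℝ) * y i - ((k * round (y i) : ℤ) : ℝ) = k * (y i - round (y i)) := by
    push_cast; ring
  rw [this, h1]; simp

theorem one_le_norm_intCast {κ : Type*} [Fintype κ] {q : κ → ℤ} (hq : q ≠ 0) :
    1 ≤ ‖fun j => (q j : ℝ)‖ := by
  obtain ⟨j, hj⟩ := Function.ne_iff.1 hq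
  refine le_trans ?_ (norm_le_pi_norm (fun j => (q j : ℝ)) j)
  rw [Real.norm_eq_abs]
  exact_mod_cast Int.one_le_abs hj

theorem finite_intVec_norm_le {κ : Type*} [Fintype κ] (R : ℝ) :
    {q : κ → ℤ | ‖fun j => (q j : ℝ)‖ ≤ R}.Finite := by
  refine (Set.Finite.pi' (t := fun _ : κ => Set.Icc (-⌊R⌋) ⌊R⌋)
    fun _ => Set.finite_Icc _ _).subset ?_
  intro q hq j
  have h := (norm_le_pi_norm (fun j => (q j : ℝ)) j).trans hq
  rw [Real.norm_eq_abs, ← Int.cast_abs] at h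
  exact abs_le.1 (Int.le_floor.2 h)

theorem diophantineExponent_nonneg {ι κ : Type*} [Fintype ι] [Fintype κ] [Nonempty κ]
    (B : Matrix ι κ ℝ) : 0 ≤ diophantineExponent B := by
  by_contra! hlt
  obtain ⟨w, hw1, hw2⟩ := EReal.lt_iff_exists_real_btwn.1 hlt
  refine absurd (le_sSup (Set.mem_image_of_mem _ ?_)) (not_le.2 hw1)
  have hw : w < 0 := by exact_mod_cast hw2
  refine Set.Infinite.mono (s := {q : κ → ℤ | q ≠ 0}) ?_ ?_
  · intro q hq
    have h1 : (1 : ℝ) ≤ ‖fun j => (q j : ℝ)‖ ^ (-w) :=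
      Real.one_le_rpow (one_le_norm_intCast hq) (by linarith)
    exact (nearestIntDist_le_half _).trans_lt (lt_of_lt_of_le (by norm_num) h1)
  · have : ({0} : Set (κ → ℤ))ᶜ.Infinite := (Set.finite_singleton _).infinite_compl
    exact this

/-- If `‖B q‖ < |q|^{-w}` has finitely many solutions, then `‖B q‖` is bounded below by a multiple
of `|q|^{-w}` for every nonzero integer vector `q`. In particular `B q` is never integral. -/
theorem exists_mul_rpow_le_nearestIntDist_of_finite {ι κ : Type*} [Fintype ι] [Fintype κ]
    (B : Matrix ι κ ℝ) {w : ℝ} (hfin : {q : κ → ℤ |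
      nearestIntDist (B *ᵥ fun j => (q j : ℝ)) < ‖fun j => (q j : ℝ)‖ ^ (-w)}.Finite) :
    ∃ c : ℝ, 0 < c ∧ ∀ q : κ → ℤ, q ≠ 0 →
      c * ‖fun j => (q j : ℝ)‖ ^ (-w) ≤ nearestIntDist (B *ᵥ fun j => (q j : ℝ)) := by
  classical
  set S : Set (κ → ℤ) := {q : κ → ℤ |
      nearestIntDist (B *ᵥ fun j => (q j : ℝ)) < ‖fun j => (q j : ℝ)‖ ^ (-w)} with hS
  change S.Finite at hfin
  have hpos : ∀ q : κ → ℤ, q ≠ 0 → 0 < nearestIntDist (B *ᵥ fun j => (q j : ℝ)) := by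
    intro q hq
    refine lt_of_le_of_ne (nearestIntDist_nonneg _) fun h0 => ?_
    -- if `B q` is integral, then so are all multiples, which all lie in the finite set `S`
    have hinj : Function.Injective fun k : ℕ => (fun j => ((k + 1 : ℕ) : ℤ) * q j) := by
      intro a b hab
      obtain ⟨j, hj⟩ := Function.ne_iff.1 hq
      have := congrFun hab j
      have := mul_right_cancel₀ hj this
      have h2 : a + 1 = b + 1 := by exact_mod_cast this
      omega
    refine Set.infinite_of_injective_forall_mem hinj (fun k => ?_) hfin
    have hne : (fun j => ((k + 1 : ℕ) : ℤ) * q j) ≠ 0 := by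
      obtain ⟨j, hj⟩ := Function.ne_iff.1 hq
      exact Function.ne_iff.2 ⟨j, mul_ne_zero (by positivity) hj⟩
    have hz := nearestIntDist_natCast_mul_eq_zero h0.symm (k + 1)
    have heq : (B *ᵥ fun j => ((((k + 1 : ℕ) : ℤ) * q j : ℤ) : ℝ)) =
        fun i => ((k + 1 : ℕ) : ℝ) * (B *ᵥ fun j => (q j : ℝ)) i := by
      ext i
      simp only [Matrix.mulVec, dotProduct, Finset.mul_sum]
      refine Finset.sum_congr rfl fun j _ => ?_
      push_cast; ring
    show nearestIntDist (B *ᵥ fun j => ((((k + 1 : ℕ) : ℤ) * q j : ℤ) : ℝ)) < _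
    rw [heq, hz]
    exact Real.rpow_pos_of_pos (lt_of_lt_of_le one_pos (one_le_norm_intCast hne)) _
  let f : (κ → ℤ) → ℝ := fun q =>
    nearestIntDist (B *ᵥ fun j => (q j : ℝ)) * ‖fun j => (q j : ℝ)‖ ^ w
  have hcancel : ∀ q : κ → ℤ, q ≠ 0 →
      ‖fun j => (q j : ℝ)‖ ^ w * ‖fun j => (q j : ℝ)‖ ^ (-w) = 1 := fun q hq => by
    rw [← Real.rpow_add (lt_of_lt_of_le one_pos (one_le_norm_intCast hq))]; simp
  obtain ⟨c, hc, hcle⟩ : ∃ c : ℝ, 0 < c ∧ ∀ q ∈ hfin.toFinset, q ≠ 0 → c ≤ f q := by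
    induction hfin.toFinset using Finset.induction_on with
    | empty => exact ⟨1, one_pos, by simp⟩
    | insert a s _ ih =>
      obtain ⟨c, hc, hs⟩ := ih
      by_cases ha : a = 0
      · refine ⟨c, hc, fun q hq hq0 => ?_⟩
        rcases Finset.mem_insert.1 hq with rfl | hq
        · exact absurd ha hq0
        · exact hs q hq hq0
      · refine ⟨min c (f a), lt_min hc (mul_pos (hpos a ha)
          (Real.rpow_pos_of_pos (lt_of_lt_of_le one_pos (one_le_norm_intCast ha)) _)),
          fun q hq hq0 => ?_⟩
        rcases Finset.mem_insert.1 hq with rfl | hq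
        · exact min_le_right _ _
        · exact (min_le_left _ _).trans (hs q hq hq0)
  refine ⟨min c 1, lt_min hc one_pos, fun q hq => ?_⟩
  have hp : 0 ≤ ‖fun j => (q j : ℝ)‖ ^ (-w) := Real.rpow_nonneg (norm_nonneg _) _
  by_cases hqS : q ∈ S
  · calc min c 1 * ‖fun j => (q j : ℝ)‖ ^ (-w) ≤ f q * ‖fun j => (q j : ℝ)‖ ^ (-w) :=
          mul_le_mul_of_nonneg_right
            ((min_le_left _ _).trans (hcle q (hfin.mem_toFinset.2 hqS) hq)) hp
      _ = _ := by simp only [f]; rw [mul_assoc, hcancel q hq, mul_one]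
  · calc min c 1 * ‖fun j => (q j : ℝ)‖ ^ (-w) ≤ 1 * ‖fun j => (q j : ℝ)‖ ^ (-w) :=
          mul_le_mul_of_nonneg_right (min_le_right _ _) hp
      _ ≤ _ := by rw [one_mul]; exact not_lt.1 hqS

theorem exists_mul_rpow_le_nearestIntDist {ι κ : Type*} [Fintype ι] [Fintype κ]
    (B : Matrix ι κ ℝ) {w : ℝ} (h : diophantineExponent B < w) :
    ∃ c : ℝ, 0 < c ∧ ∀ q : κ → ℤ, q ≠ 0 →
      c * ‖fun j => (q j : ℝ)‖ ^ (-w) ≤ nearestIntDist (B *ᵥ fun j => (q j : ℝ)) := by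
  refine exists_mul_rpow_le_nearestIntDist_of_finite B ?_
  by_contra hinf
  exact absurd (le_sSup (Set.mem_image_of_mem _ hinf)) (not_le.2 h)

/-! ### Counting integer points by exponential sums and by separation -/

/-- The additive character `x ↦ e^{2πix}` of `ℝ`. -/
noncomputable def expTwoPiI (x : ℝ) : ℂ := Complex.exp (Complex.I * ((2 * Real.pi * x : ℝ) : ℂ))

theorem expTwoPiI_add (x y : ℝ) : expTwoPiI (x + y) = expTwoPiI x * expTwoPiI y := by
  rw [expTwoPiI, expTwoPiI, expTwoPiI, ← Complex.exp_add]; congr 1; push_cast; ring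

theorem expTwoPiI_zero : expTwoPiI 0 = 1 := by simp [expTwoPiI]

theorem norm_expTwoPiI (x : ℝ) : ‖expTwoPiI x‖ = 1 := by
  rw [expTwoPiI, mul_comm]; exact Complex.norm_exp_ofReal_mul_I _

theorem expTwoPiI_intCast (k : ℤ) : expTwoPiI k = 1 := by
  rw [expTwoPiI, Complex.exp_eq_one_iff]; exact ⟨k, by push_cast; ring⟩

theorem expTwoPiI_sub_intCast (x : ℝ) (k : ℤ) : expTwoPiI (x - k) = expTwoPiI x := by
  have := expTwoPiI_add (x - k) k
  rw [expTwoPiI_intCast, mul_one, sub_add_cancel] at this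
  exact this.symm

theorem expTwoPiI_sum {ι : Type*} (s : Finset ι) (f : ι → ℝ) :
    expTwoPiI (∑ i ∈ s, f i) = ∏ i ∈ s, expTwoPiI (f i) := by
  classical
  induction s using Finset.induction_on with
  | empty => simp [expTwoPiI_zero]
  | insert a s ha ih => rw [Finset.sum_insert ha, Finset.prod_insert ha, expTwoPiI_add, ih]

theorem conj_expTwoPiI (x : ℝ) : (starRingEnd ℂ) (expTwoPiI x) = expTwoPiI (-x) := by
  rw [expTwoPiI, expTwoPiI, ← Complex.exp_conj, map_mul, Complex.conj_I, Complex.conj_ofReal]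
  congr 1; push_cast; ring

theorem expTwoPiI_natCast_mul (j : ℕ) (x : ℝ) : expTwoPiI (j * x) = expTwoPiI x ^ j := by
  rw [expTwoPiI, expTwoPiI, ← Complex.exp_nat_mul]; congr 1; push_cast; ring

theorem norm_expTwoPiI_sub_one (x : ℝ) :
    ‖expTwoPiI x - 1‖ = 2 * |Real.sin (Real.pi * x)| := by
  rw [expTwoPiI, Complex.norm_exp_I_mul_ofReal_sub_one, norm_mul, Real.norm_eq_abs,
    Real.norm_eq_abs, abs_two]
  congr 3; ring

theorem norm_expTwoPiI_sub_one_le (x : ℝ) : ‖expTwoPiI x - 1‖ ≤ 2 * Real.pi * |x| := by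
  rw [norm_expTwoPiI_sub_one, mul_assoc]
  have h : |Real.sin (Real.pi * x)| ≤ |Real.pi * x| := Real.abs_sin_le_abs
  rw [abs_mul, abs_of_pos Real.pi_pos] at h
  linarith

theorem le_norm_expTwoPiI_sub_one (x : ℝ) : 4 * |x - round x| ≤ ‖expTwoPiI x - 1‖ := by
  rw [← expTwoPiI_sub_intCast x (round x), norm_expTwoPiI_sub_one]
  have hpi := Real.pi_pos
  have h1 : |Real.pi * (x - round x)| ≤ Real.pi / 2 := by
    rw [abs_mul, abs_of_pos hpi]
    have := abs_sub_round x
    nlinarith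
  have h2 := Real.mul_abs_le_abs_sin h1
  rw [abs_mul, abs_of_pos hpi] at h2
  have h3 : 2 / Real.pi * (Real.pi * |x - round x|) = 2 * |x - round x| := by field_simp
  linarith

theorem norm_sum_expTwoPiI_le_card (V : ℕ) (α : ℝ) :
    ‖∑ j ∈ Finset.range V, expTwoPiI (j * α)‖ ≤ V := by
  refine (norm_sum_le _ _).trans ?_
  simp [norm_expTwoPiI]

theorem norm_sum_expTwoPiI_le (V : ℕ) {α ρ : ℝ} (hρ : 0 < ρ) (h : ρ ≤ |α - round α|) :
    ‖∑ j ∈ Finset.range V, expTwoPiI (j * α)‖ ≤ 1 / (2 * ρ) := by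
  simp_rw [expTwoPiI_natCast_mul]
  have h1 := geom_sum_mul (expTwoPiI α) V
  have h2 : ‖expTwoPiI α ^ V - 1‖ ≤ 2 := by
    refine (norm_sub_le _ _).trans ?_
    rw [norm_pow, norm_expTwoPiI]; norm_num
  rw [← h1, norm_mul] at h2
  have h3 := le_norm_expTwoPiI_sub_one α
  rw [le_div_iff₀ (by positivity)]
  nlinarith [norm_nonneg (∑ i ∈ Finset.range V, expTwoPiI α ^ i)]

theorem le_norm_sum_expTwoPiI {H : ℕ} (hH : 0 < H) {x : ℝ}
    (h : |x - round x| ≤ 1 / (4 * Real.pi * H)) :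
    (H : ℝ) / 2 ≤ ‖∑ j ∈ Finset.range H, expTwoPiI (j * x)‖ := by
  have hH' : (0 : ℝ) < H := by exact_mod_cast hH
  have hpi := Real.pi_pos
  have h1 : ‖∑ j ∈ Finset.range H, expTwoPiI (j * x) - H‖ ≤ H / 2 := by
    have : ∑ j ∈ Finset.range H, expTwoPiI (j * x) - H =
        ∑ j ∈ Finset.range H, (expTwoPiI (j * x) - 1) := by simp
    rw [this]
    refine (norm_sum_le_of_le _ (f := fun j : ℕ => expTwoPiI (j * x) - 1)
      (n := fun _ => (1 : ℝ) / 2) fun j hj => ?_).trans ?_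
    · have e : expTwoPiI (j * x) = expTwoPiI (j * (x - round x)) := by
        rw [mul_sub, ← expTwoPiI_sub_intCast (j * x) (j * round x)]; push_cast; rfl
      rw [e]
      refine (norm_expTwoPiI_sub_one_le _).trans ?_
      have hj' : (j : ℝ) ≤ H := by exact_mod_cast (Finset.mem_range.1 hj).le
      rw [abs_mul, Nat.abs_cast]
      calc 2 * Real.pi * (j * |x - round x|)
          ≤ 2 * Real.pi * (H * (1 / (4 * Real.pi * H))) := by gcongr
        _ = 1 / 2 := by field_simp; norm_num
    · simp; linarith
  have h2 := norm_sub_norm_le (H : ℂ) (∑ j ∈ Finset.range H, expTwoPiI (j * x))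
  rw [norm_sub_rev] at h2
  simp only [Complex.norm_natCast] at h2
  linarith

/-- The exponential sum over the integer points of the cube `[0, V)^ι`. -/
noncomputable def cubeExpSum {ι : Type*} [Fintype ι] [DecidableEq ι] (V : ℕ) (α : ι → ℝ) : ℂ :=
  ∑ v ∈ Fintype.piFinset fun _ : ι => Finset.range V, expTwoPiI (∑ i, (v i : ℝ) * α i)

theorem cubeExpSum_eq_prod {ι : Type*} [Fintype ι] [DecidableEq ι] (V : ℕ) (α : ι → ℝ) :
    cubeExpSum V α = ∏ i, ∑ j ∈ Finset.range V, expTwoPiI (j * α i) := by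
  rw [Finset.prod_univ_sum, cubeExpSum]
  exact Finset.sum_congr rfl fun v _ => expTwoPiI_sum _ _

theorem norm_cubeExpSum_le_card {ι : Type*} [Fintype ι] [DecidableEq ι] (V : ℕ) (α : ι → ℝ) :
    ‖cubeExpSum V α‖ ≤ (V : ℝ) ^ Fintype.card ι := by
  rw [cubeExpSum_eq_prod, norm_prod]
  refine (Finset.prod_le_prod (fun _ _ => norm_nonneg _)
    fun i _ => norm_sum_expTwoPiI_le_card V (α i)).trans ?_
  simp

theorem norm_cubeExpSum_le {ι : Type*} [Fintype ι] [DecidableEq ι] {V : ℕ} (hV : 0 < V)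
    {α : ι → ℝ} {ρ : ℝ} (hρ : 0 < ρ) (h : ρ ≤ nearestIntDist α) :
    ‖cubeExpSum V α‖ ≤ (V : ℝ) ^ Fintype.card ι * (1 / (2 * ρ * V)) := by
  obtain ⟨i, hi⟩ := exists_le_abs_sub_round hρ h
  have hV' : (0 : ℝ) < V := by exact_mod_cast hV
  rw [cubeExpSum_eq_prod, norm_prod, ← Finset.mul_prod_erase _ _ (Finset.mem_univ i)]
  have h1 := norm_sum_expTwoPiI_le V hρ hi
  have h2 : ∏ j ∈ Finset.univ.erase i, ‖∑ t ∈ Finset.range V, expTwoPiI (t * α j)‖ ≤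
      (V : ℝ) ^ (Fintype.card ι - 1) := by
    refine (Finset.prod_le_prod (fun _ _ => norm_nonneg _)
      fun i _ => norm_sum_expTwoPiI_le_card V (α i)).trans ?_
    simp [Finset.card_erase_of_mem]
  have h3 : (V : ℝ) ^ Fintype.card ι = V ^ (Fintype.card ι - 1) * V := by
    rw [← pow_succ, Nat.sub_add_cancel (Fintype.card_pos_iff.2 ⟨i⟩)]
  calc _ ≤ 1 / (2 * ρ) * (V : ℝ) ^ (Fintype.card ι - 1) := by gcongr
    _ = _ := by rw [h3]; field_simp

theorem le_norm_cubeExpSum {κ : Type*} [Fintype κ] [DecidableEq κ] {H : ℕ} (hH : 0 < H)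
    {x : κ → ℝ} (h : nearestIntDist x ≤ 1 / (4 * Real.pi * H)) :
    ((H : ℝ) / 2) ^ Fintype.card κ ≤ ‖cubeExpSum H x‖ := by
  rw [cubeExpSum_eq_prod, norm_prod, Fintype.card, ← Finset.prod_const]
  exact Finset.prod_le_prod (fun _ _ => by positivity) fun j _ =>
    le_norm_sum_expTwoPiI hH ((abs_sub_round_le_nearestIntDist x j).trans h)

/-- Expansion of `|∑ₕ e(h·(vA + β))|²` as a trigonometric polynomial in `v`. -/
theorem norm_sq_cubeExpSum_vecMul {ι κ : Type*} [Fintype ι] [Fintype κ] [DecidableEq κ]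
    (A : Matrix ι κ ℝ) (β : κ → ℝ) (H : ℕ) (v : ι → ℝ) :
    ((‖cubeExpSum H (v ᵥ* A + β)‖ ^ 2 : ℝ) : ℂ) =
      ∑ h ∈ Fintype.piFinset fun _ : κ => Finset.range H,
        ∑ h' ∈ Fintype.piFinset fun _ : κ => Finset.range H,
          expTwoPiI (∑ j, ((h j : ℝ) - h' j) * β j) *
            expTwoPiI (∑ i, v i * (A *ᵥ fun j => ((h j : ℝ) - h' j)) i) := by
  rw [Complex.ofReal_pow, ← Complex.mul_conj', cubeExpSum, map_sum, Finset.sum_mul_sum]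
  refine Finset.sum_congr rfl fun h _ => Finset.sum_congr rfl fun h' _ => ?_
  rw [conj_expTwoPiI, ← expTwoPiI_add, ← expTwoPiI_add]
  congr 1
  have : ∑ i, v i * (A *ᵥ fun j => ((h j : ℝ) - h' j)) i =
      ∑ j, (v ᵥ* A) j * ((h j : ℝ) - h' j) := Matrix.dotProduct_mulVec v A _
  rw [this, ← Finset.sum_neg_distrib, ← Finset.sum_add_distrib, ← Finset.sum_add_distrib]
  refine Finset.sum_congr rfl fun j _ => ?_
  simp only [Pi.add_apply]; ring

theorem sum_expTwoPiI_translates {ι : Type*} [Fintype ι] [DecidableEq ι] (V k : ℕ) (α : ι → ℝ)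
    (B : Finset (ι → ℤ)) :
    ∑ l ∈ Fintype.piFinset fun _ : Fin k => Fintype.piFinset fun _ : ι => Finset.range V,
      ∑ b ∈ B, expTwoPiI (∑ i, ((b i : ℝ) + ∑ a, (l a i : ℝ)) * α i) =
    (∑ b ∈ B, expTwoPiI (∑ i, (b i : ℝ) * α i)) * cubeExpSum V α ^ k := by
  have h1 : cubeExpSum V α ^ k = ∏ _a : Fin k, cubeExpSum V α := by simp
  have h2 : ∏ _a : Fin k, cubeExpSum V α =
      ∑ l ∈ Fintype.piFinset fun _ : Fin k => Fintype.piFinset fun _ : ι => Finset.range V,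
        ∏ a, expTwoPiI (∑ i, (l a i : ℝ) * α i) := by
    unfold cubeExpSum
    rw [Finset.prod_univ_sum]
  rw [h1, h2, Finset.mul_sum]
  refine Finset.sum_congr rfl fun l _ => ?_
  rw [Finset.sum_mul]
  refine Finset.sum_congr rfl fun b _ => ?_
  rw [← expTwoPiI_sum, ← expTwoPiI_add]
  congr 1
  rw [Finset.sum_comm, ← Finset.sum_add_distrib]
  refine Finset.sum_congr rfl fun i _ => ?_
  rw [← Finset.sum_mul]; ring

/-- Counting integer points `v` in a box for which `vA + β` is close to an integer vector.
If `A h` stays at distance `ρ` from integer vectors for all `0 < |h| < H`, the count has the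
expected order of magnitude, up to an error which decays like an arbitrary power of `1 / (ρ V)`.
The smoothing parameter `k` is the number of additional averages over cubes of side `V`. -/
theorem card_nearestIntDist_vecMul_add_le {ι κ : Type*} [Fintype ι] [Fintype κ]
    (A : Matrix ι κ ℝ) (β : κ → ℝ) {H V : ℕ} (k : ℕ) (hH : 0 < H) (hV : 0 < V) {ρ : ℝ}
    (hρ : 0 < ρ)
    (hA : ∀ h : κ → ℤ, h ≠ 0 → (∀ j, |h j| < H) → ρ ≤ nearestIntDist (A *ᵥ fun j => (h j : ℝ)))
    (P : Finset (ι → ℤ)) (hP : ∀ v ∈ P, ∀ i, |v i| ≤ V)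
    (hPA : ∀ v ∈ P,
      nearestIntDist ((fun i => (v i : ℝ)) ᵥ* A + β) ≤ 1 / (4 * Real.pi * H)) :
    (P.card : ℝ) ≤ 4 ^ Fintype.card κ * ((k + 3) * V) ^ Fintype.card ι *
      (1 / (H : ℝ) ^ Fintype.card κ + (1 / (2 * ρ * V)) ^ k) := by
  classical
  have hH' : (0 : ℝ) < H := by exact_mod_cast hH
  have hV' : (0 : ℝ) < V := by exact_mod_cast hV
  set LL := Fintype.piFinset fun _ : Fin k => Fintype.piFinset fun _ : ι => Finset.range V with hLL
  set HB := Fintype.piFinset fun _ : κ => Finset.range H with hHB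
  set B : Finset (ι → ℤ) :=
    Fintype.piFinset fun _ : ι => Finset.Icc (-((k + 1 : ℤ) * V)) V with hB
  let F : (ι → ℝ) → ℝ := fun v => ‖cubeExpSum H (v ᵥ* A + β)‖ ^ 2
  have hF0 : ∀ v, 0 ≤ F v := fun v => by positivity
  have hLcard : (LL.card : ℝ) = (V : ℝ) ^ (Fintype.card ι * k) := by
    simp [hLL, Fintype.card_piFinset, ← pow_mul]
  have hHcard : (HB.card : ℝ) = (H : ℝ) ^ Fintype.card κ := by
    simp [hHB, Fintype.card_piFinset]
  have hBcard : (B.card : ℝ) ≤ ((k + 3) * V) ^ Fintype.card ι := by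
    have h1 : B.card = ((k + 2) * V + 1) ^ Fintype.card ι := by
      rw [hB, Fintype.card_piFinset, Finset.prod_const, Int.card_Icc]
      congr 1
      have : (V : ℤ) + 1 - -((k + 1 : ℤ) * V) = (((k + 2) * V + 1 : ℕ) : ℤ) := by push_cast; ring
      rw [this, Int.toNat_natCast]
    rw [h1]
    push_cast
    have : (1 : ℝ) ≤ V := by exact_mod_cast hV
    exact pow_le_pow_left₀ (by positivity) (by linarith) _
  -- each point of `P` is counted once for every `l`
  have hlow : (V : ℝ) ^ (Fintype.card ι * k) * (P.card * ((H : ℝ) / 2) ^ (2 * Fintype.card κ)) ≤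
      ∑ l ∈ LL, ∑ b ∈ B, F fun i => (b i : ℝ) + ∑ a, (l a i : ℝ) := by
    rw [← hLcard, ← nsmul_eq_mul]
    refine Finset.card_nsmul_le_sum _ _ _ fun l hl => ?_
    have hl' : ∀ a i, l a i < V := fun a i =>
      Finset.mem_range.1 (Fintype.mem_piFinset.1 (Fintype.mem_piFinset.1 hl a) i)
    have hinj : Function.Injective fun v : ι → ℤ => fun i => v i - ∑ a, (l a i : ℤ) := by
      intro v v' h
      ext i
      have := congrFun h i
      simp only at this
      linarith
    have hsub : P.map ⟨_, hinj⟩ ⊆ B := by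
      intro b hb
      obtain ⟨v, hv, rfl⟩ := Finset.mem_map.1 hb
      refine Fintype.mem_piFinset.2 fun i => Finset.mem_Icc.2 ?_
      have h1 := abs_le.1 (hP v hv i)
      have h2 : (0 : ℤ) ≤ ∑ a, (l a i : ℤ) := Finset.sum_nonneg fun a _ => by positivity
      have h3 : ∑ a, (l a i : ℤ) ≤ k * V := by
        refine (Finset.sum_le_card_nsmul _ _ (V : ℤ)
          fun a _ => by exact_mod_cast (hl' a i).le).trans ?_
        simp
      simp only [Function.Embedding.coeFn_mk]
      constructor <;> linarith
    calc (P.card : ℝ) * ((H : ℝ) / 2) ^ (2 * Fintype.card κ)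
        ≤ ∑ v ∈ P, F fun i => (v i : ℝ) := by
          rw [← nsmul_eq_mul]
          refine Finset.card_nsmul_le_sum _ _ _ fun v hv => ?_
          rw [mul_comm 2, pow_mul]
          exact pow_le_pow_left₀ (by positivity) (le_norm_cubeExpSum hH (hPA v hv)) 2
      _ = ∑ b ∈ P.map ⟨_, hinj⟩, F fun i => (b i : ℝ) + ∑ a, (l a i : ℝ) := by
          rw [Finset.sum_map]
          refine Finset.sum_congr rfl fun v _ => ?_
          congr 1; ext i; simp
      _ ≤ _ := Finset.sum_le_sum_of_subset_of_nonneg hsub fun _ _ _ => hF0 _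
  have hupp : ∑ l ∈ LL, ∑ b ∈ B, F (fun i => (b i : ℝ) + ∑ a, (l a i : ℝ)) ≤
      (B.card : ℝ) * ((V : ℝ) ^ (Fintype.card ι * k) * ((H : ℝ) ^ Fintype.card κ +
        (H : ℝ) ^ (2 * Fintype.card κ) * (1 / (2 * ρ * V)) ^ k)) := by
    set α : (κ → ℕ) → (κ → ℕ) → ι → ℝ := fun h h' => A *ᵥ fun j => ((h j : ℝ) - h' j)
    have hexp : ((∑ l ∈ LL, ∑ b ∈ B, F (fun i => (b i : ℝ) + ∑ a, (l a i : ℝ)) : ℝ) : ℂ) =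
        ∑ h ∈ HB, ∑ h' ∈ HB, expTwoPiI (∑ j, ((h j : ℝ) - h' j) * β j) *
          ((∑ b ∈ B, expTwoPiI (∑ i, (b i : ℝ) * α h h' i)) * cubeExpSum V (α h h') ^ k) := by
      simp_rw [← sum_expTwoPiI_translates, Complex.ofReal_sum, F, norm_sq_cubeExpSum_vecMul,
        Finset.mul_sum]
      rw [Finset.sum_congr rfl fun l _ => Finset.sum_comm, Finset.sum_comm]
      refine Finset.sum_congr rfl fun h _ => ?_
      rw [Finset.sum_congr rfl fun l _ => Finset.sum_comm, Finset.sum_comm]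
    have hterm : ∀ h ∈ HB, ∀ h' ∈ HB, ‖expTwoPiI (∑ j, ((h j : ℝ) - h' j) * β j) *
          ((∑ b ∈ B, expTwoPiI (∑ i, (b i : ℝ) * α h h' i)) * cubeExpSum V (α h h') ^ k)‖ ≤
        B.card * (V : ℝ) ^ (Fintype.card ι * k) *
          ((if h = h' then 1 else 0) + (1 / (2 * ρ * V)) ^ k) := by
      intro h hh h' hh'
      rw [norm_mul, norm_expTwoPiI, one_mul, norm_mul, norm_pow, mul_assoc]
      have hb : ‖∑ b ∈ B, expTwoPiI (∑ i, (b i : ℝ) * α h h' i)‖ ≤ B.card := by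
        refine (norm_sum_le _ _).trans ?_
        simp [norm_expTwoPiI]
      refine mul_le_mul hb ?_ (by positivity) (by positivity)
      by_cases heq : h = h'
      · rw [if_pos heq, pow_mul]
        calc ‖cubeExpSum V (α h h')‖ ^ k ≤ ((V : ℝ) ^ Fintype.card ι) ^ k :=
              pow_le_pow_left₀ (norm_nonneg _) (norm_cubeExpSum_le_card V _) k
          _ ≤ _ := le_mul_of_one_le_right (by positivity)
              (le_add_of_nonneg_right (by positivity))
      · rw [if_neg heq, zero_add, pow_mul, ← mul_pow]
        refine pow_le_pow_left₀ (norm_nonneg _) (norm_cubeExpSum_le hV hρ ?_) k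
        have hne : (fun j => (h j : ℤ) - h' j) ≠ 0 := by
          intro h0
          apply heq
          ext j
          have := congrFun h0 j
          simp only [Pi.zero_apply] at this
          omega
        have := hA _ hne fun j => by
          have h1 := Finset.mem_range.1 (Fintype.mem_piFinset.1 hh j)
          have h2 := Finset.mem_range.1 (Fintype.mem_piFinset.1 hh' j)
          rw [abs_lt]; omega
        simpa [α] using this
    have hnorm := congrArg norm hexp
    rw [Complex.norm_real, Real.norm_of_nonneg
      (Finset.sum_nonneg fun _ _ => Finset.sum_nonneg fun _ _ => hF0 _)] at hnorm
    rw [hnorm]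
    refine (norm_sum_le_of_le _ fun h hh => norm_sum_le_of_le _ fun h' hh' =>
      hterm h hh h' hh').trans (le_of_eq ?_)
    simp_rw [← Finset.mul_sum, Finset.sum_add_distrib, Finset.sum_ite_eq]
    rw [Finset.sum_ite_mem, Finset.inter_self]
    simp only [Finset.sum_const, nsmul_eq_mul, hHcard, mul_one]
    ring
  have h := hlow.trans hupp
  have h1 : (P.card : ℝ) * ((H : ℝ) / 2) ^ (2 * Fintype.card κ) ≤
      (B.card : ℝ) * ((H : ℝ) ^ Fintype.card κ +
        (H : ℝ) ^ (2 * Fintype.card κ) * (1 / (2 * ρ * V)) ^ k) := by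
    have hVp : (0 : ℝ) < (V : ℝ) ^ (Fintype.card ι * k) := by positivity
    refine le_of_mul_le_mul_left (h.trans (le_of_eq ?_)) hVp
    ring
  have h2 : (P.card : ℝ) * ((H : ℝ) / 2) ^ (2 * Fintype.card κ) =
      P.card * ((H : ℝ) ^ (2 * Fintype.card κ) / 4 ^ Fintype.card κ) := by
    rw [div_pow, pow_mul 2 2]; norm_num
  have h3 : (H : ℝ) ^ Fintype.card κ = (H : ℝ) ^ (2 * Fintype.card κ) *
      (1 / (H : ℝ) ^ Fintype.card κ) := by
    rw [two_mul, pow_add]; field_simp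
  rw [h2, h3, ← mul_add, mul_left_comm] at h1
  have hHp : (0 : ℝ) < (H : ℝ) ^ (2 * Fintype.card κ) := by positivity
  rw [mul_div_assoc', mul_comm (P.card : ℝ), mul_div_assoc] at h1
  have h4 := le_of_mul_le_mul_left h1 hHp
  rw [div_le_iff₀ (by positivity)] at h4
  refine h4.trans ?_
  rw [mul_comm, ← mul_assoc]
  gcongr

/-- Pigeonhole bound for the number of points `v` with `vA + β` close to an integer vector, when
the points `vA` are `ρ`-separated modulo integer vectors. -/
theorem card_le_of_separated {ι κ : Type*} [Fintype ι] [Fintype κ]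
    (A : Matrix ι κ ℝ) (β : κ → ℝ) {Q : ℤ} {ρ δ : ℝ} (hρ : 0 < ρ) (hδ : 0 ≤ δ)
    (hA : ∀ v : ι → ℤ, v ≠ 0 → (∀ i, |v i| ≤ 2 * Q) →
      ρ ≤ nearestIntDist ((fun i => (v i : ℝ)) ᵥ* A))
    (P : Finset (ι → ℤ)) (hP : ∀ v ∈ P, ∀ i, |v i| ≤ Q)
    (hPA : ∀ v ∈ P, nearestIntDist ((fun i => (v i : ℝ)) ᵥ* A + β) ≤ δ) :
    (P.card : ℝ) ≤ (2 * (δ / ρ) + 2) ^ Fintype.card κ := by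
  classical
  set x : (ι → ℤ) → κ → ℝ := fun v => (fun i => (v i : ℝ)) ᵥ* A + β with hx
  set c : (ι → ℤ) → κ → ℤ := fun v j => ⌊(x v j - round (x v j)) / ρ⌋ with hc
  set T : Finset (κ → ℤ) := Fintype.piFinset fun _ => Finset.Icc ⌊-(δ / ρ)⌋ ⌊δ / ρ⌋ with hT
  have hmaps : ∀ v ∈ P, c v ∈ T := by
    intro v hv
    refine Fintype.mem_piFinset.2 fun j => Finset.mem_Icc.2 ?_
    have h := abs_le.1 ((abs_sub_round_le_nearestIntDist (x v) j).trans (hPA v hv))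
    constructor
    · refine Int.floor_le_floor ?_
      rw [← neg_div]; gcongr; exact h.1
    · refine Int.floor_le_floor ?_
      gcongr; exact h.2
  have hinj : Set.InjOn c P := by
    intro v hv v' hv' hcc
    by_contra hne
    have h1 := hA (v - v') (sub_ne_zero.2 hne) fun i => by
      have := abs_sub (v i) (v' i)
      have a1 := hP v hv i
      have a2 := hP v' hv' i
      simp only [Pi.sub_apply]; linarith
    refine absurd (nearestIntDist_lt_of_forall hρ
      (fun j => round (x v j) - round (x v' j)) fun j => ?_) (not_lt.2 h1)
    have h2 := Int.abs_sub_lt_one_of_floor_eq_floor (congrFun hcc j)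
    rw [← sub_div, abs_div, abs_of_pos hρ, div_lt_one hρ] at h2
    have h3 : (fun i => (((v - v') i : ℤ) : ℝ)) = (fun i => (v i : ℝ)) - fun i => (v' i : ℝ) := by
      ext i; simp
    have h4 : ((fun i => (((v - v') i : ℤ) : ℝ)) ᵥ* A) j -
        ((round (x v j) - round (x v' j) : ℤ) : ℝ) =
        x v j - round (x v j) - (x v' j - round (x v' j)) := by
      rw [h3, Matrix.sub_vecMul]
      simp only [hx, Pi.add_apply, Pi.sub_apply]
      push_cast; ring
    rw [h4]
    exact h2
  have hcard : (P.card : ℝ) ≤ T.card := by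
    exact_mod_cast Finset.card_le_card_of_injOn c hmaps hinj
  refine hcard.trans ?_
  rw [hT, Fintype.card_piFinset, Finset.prod_const]
  push_cast
  refine pow_le_pow_left₀ (by positivity) ?_ _
  have h0 : 0 ≤ δ / ρ := by positivity
  have h1 : ⌊-(δ / ρ)⌋ ≤ ⌊δ / ρ⌋ + 1 := by
    have := Int.floor_le_floor (a := -(δ / ρ)) (b := δ / ρ) (by linarith)
    omega
  rw [Int.card_Icc, ← Int.cast_natCast, Int.toNat_of_nonneg (by omega)]
  push_cast
  have h2 := Int.floor_le (δ / ρ)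
  have h3 := Int.lt_floor_add_one (-(δ / ρ))
  linarith

/-! ### Null sets on the affine subspace and the convergence argument -/

/-- The parametrization `x ↦ (x, x̃ A)` of the affine subspace `affineSubspaceOfMatrix A`. -/
noncomputable def affineParam {d m : ℕ} (A : Matrix (Fin (d + 1)) (Fin m) ℝ) (x : Fin d → ℝ) :
    EuclideanSpace ℝ (Fin (d + m)) :=
  WithLp.toLp 2 (Fin.append x ((Fin.cons 1 x : Fin (d + 1) → ℝ) ᵥ* A))

theorem affineParam_castAdd {d m : ℕ} (A : Matrix (Fin (d + 1)) (Fin m) ℝ) (x : Fin d → ℝ)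
    (i : Fin d) : affineParam A x (Fin.castAdd m i) = x i := by
  simp [affineParam]

theorem affineParam_natAdd {d m : ℕ} (A : Matrix (Fin (d + 1)) (Fin m) ℝ) (x : Fin d → ℝ)
    (j : Fin m) : affineParam A x (Fin.natAdd d j) = A 0 j + ∑ i, x i * A i.succ j := by
  simp [affineParam, Matrix.vecMul, dotProduct, Fin.sum_univ_succ]

/-- The linear part of `affineParam A`. -/
noncomputable def affineParamLinear {d m : ℕ} (A : Matrix (Fin (d + 1)) (Fin m) ℝ) :
    (Fin d → ℝ) →ₗ[ℝ] EuclideanSpace ℝ (Fin (d + m)) where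
  toFun x := WithLp.toLp 2 (Fin.append x fun j => ∑ i, x i * A i.succ j)
  map_add' x y := by
    ext i
    refine Fin.addCases (fun i => ?_) (fun j => ?_) i
    · simp
    · simp [add_mul, Finset.sum_add_distrib]
  map_smul' c x := by
    ext i
    refine Fin.addCases (fun i => ?_) (fun j => ?_) i
    · simp
    · simp [mul_assoc, Finset.mul_sum]

theorem affineParam_sub {d m : ℕ} (A : Matrix (Fin (d + 1)) (Fin m) ℝ) (x y : Fin d → ℝ) :
    affineParam A x - affineParam A y = affineParamLinear A (x - y) := by
  ext i
  refine Fin.addCases (fun i => ?_) (fun j => ?_) i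
  · simp [affineParamLinear, affineParam_castAdd]
  · simp [affineParamLinear, affineParam_natAdd, sub_mul]

theorem exists_lipschitzWith_affineParam {d m : ℕ} (A : Matrix (Fin (d + 1)) (Fin m) ℝ) :
    ∃ K, LipschitzWith K (affineParam A) := by
  refine ⟨‖(affineParamLinear A).toContinuousLinearMap‖₊,
    LipschitzWith.of_dist_le_mul fun x y => ?_⟩
  rw [dist_eq_norm, dist_eq_norm, affineParam_sub]
  exact (affineParamLinear A).toContinuousLinearMap.le_opNorm _

/-- Null sets of the affine subspace are the images of null sets of `ℝᵈ`, since the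
parametrization is bi-Lipschitz. -/
theorem inducedLebesgue_inter_eq_zero_iff {d m : ℕ} (A : Matrix (Fin (d + 1)) (Fin m) ℝ)
    (S : Set (EuclideanSpace ℝ (Fin (d + m)))) :
    inducedLebesgue d (affineSubspaceOfMatrix A) (S ∩ affineSubspaceOfMatrix A) = 0 ↔
      volume (affineParam A ⁻¹' S) = 0 := by
  have himg : S ∩ affineSubspaceOfMatrix A = affineParam A '' (affineParam A ⁻¹' S) :=
    Set.image_preimage_eq_inter_range.symm
  have hvol : (volume : Measure (Fin d → ℝ)) = μH[(d : ℝ)] := by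
    rw [← hausdorffMeasure_pi_real, Fintype.card_fin]
  rw [inducedLebesgue, Measure.restrict_eq_self _ Set.inter_subset_right, himg,
    Measure.euclideanHausdorffMeasure_def, Measure.smul_apply, hvol]
  set T := affineParam A ⁻¹' S
  have hc := Measure.addHaarScalarFactor_volume_hausdorffMeasure_ne_zero d
  rw [ENNReal.smul_def, smul_eq_mul, mul_eq_zero]
  constructor
  · rintro (h | h)
    · exact absurd (by exact_mod_cast h) hc
    · let pr : EuclideanSpace ℝ (Fin (d + m)) → Fin d → ℝ := fun y i => y (Fin.castAdd m i)
      have hpr : LipschitzWith 1 pr := by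
        refine LipschitzWith.of_dist_le_mul fun y z => ?_
        rw [NNReal.coe_one, one_mul, dist_eq_norm, dist_eq_norm]
        exact (pi_norm_le_iff_of_nonneg (norm_nonneg _)).2 fun i =>
          PiLp.norm_apply_le (y - z) (Fin.castAdd m i)
      have h1 := hpr.hausdorffMeasure_image_le (Nat.cast_nonneg d) (affineParam A '' T)
      rw [h, mul_zero, Set.image_image] at h1
      have h2 : (fun x => pr (affineParam A x)) '' T = T := by
        have : (fun x => pr (affineParam A x)) = id := by
          ext x i; exact affineParam_castAdd A x i
        rw [this, Set.image_id]
      rw [h2] at h1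
      exact le_antisymm h1 bot_le
  · intro h
    right
    obtain ⟨K, hK⟩ := exists_lipschitzWith_affineParam A
    have h1 := hK.hausdorffMeasure_image_le (Nat.cast_nonneg d) T
    rw [h, mul_zero] at h1
    exact le_antisymm h1 bot_le

/-- The translation that the shift `θ` produces in the last `m` coordinates after it has been
removed from the first `d` coordinates. -/
noncomputable def affineShift {d m : ℕ} (A : Matrix (Fin (d + 1)) (Fin m) ℝ)
    (θ : EuclideanSpace ℝ (Fin (d + m))) (j : Fin m) : ℝ :=
  ∑ i : Fin d, θ (Fin.castAdd m i) * A i.succ j - θ (Fin.natAdd d j)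

/-- If `q φ(x)` is close to `θ` modulo integer vectors, where `φ = affineParam A`, then `x` is
close to a rational point `(p + θ') / q` for which `(q, p) A` is close to a fixed translate of an
integer vector. -/
theorem exists_intVec_of_nearestIntDist_lt {d m : ℕ} (A : Matrix (Fin (d + 1)) (Fin m) ℝ)
    (θ : EuclideanSpace ℝ (Fin (d + m))) {q : ℕ} {x : Fin d → ℝ} {r : ℝ}
    (h : nearestIntDist (fun i => (q : ℝ) * affineParam A x i - θ i) < r) :
    ∃ v : Fin (d + 1) → ℤ, v 0 = q ∧
      (∀ i : Fin d, |q * x i - (v i.succ + θ (Fin.castAdd m i))| ≤ r) ∧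
      nearestIntDist ((fun i => (v i : ℝ)) ᵥ* A + affineShift A θ) ≤
        (1 + ∑ i, ∑ j, |A i j|) * r := by
  have hr : 0 < r := (nearestIntDist_nonneg _).trans_lt h
  set k : Fin (d + m) → ℤ := fun i => round ((q : ℝ) * affineParam A x i - θ i) with hk
  have hki : ∀ i, |(q : ℝ) * affineParam A x i - θ i - k i| ≤ r := fun i =>
    (abs_sub_round_le_nearestIntDist (fun i => (q : ℝ) * affineParam A x i - θ i) i).trans h.le
  set u : Fin d → ℝ := fun i => q * x i - (k (Fin.castAdd m i) + θ (Fin.castAdd m i)) with hu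
  have hui : ∀ i, |u i| ≤ r := fun i => by
    have := hki (Fin.castAdd m i)
    rw [affineParam_castAdd] at this
    rw [hu]; convert this using 2; ring
  have hS : 0 ≤ ∑ i, ∑ j, |A i j| :=
    Finset.sum_nonneg fun _ _ => Finset.sum_nonneg fun _ _ => abs_nonneg _
  refine ⟨Fin.cons (q : ℤ) fun i => k (Fin.castAdd m i), by simp, fun i => by
    simpa [hu] using hui i, nearestIntDist_le_of_forall (by positivity)
      (fun j => k (Fin.natAdd d j)) fun j => ?_⟩
  have h1 := hki (Fin.natAdd d j)
  rw [affineParam_natAdd] at h1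
  have h2 : |∑ i, u i * A i.succ j| ≤ (∑ i, ∑ j, |A i j|) * r := by
    refine (Finset.abs_sum_le_sum_abs _ _).trans ?_
    rw [Fin.sum_univ_succ, add_mul,
      Finset.sum_mul Finset.univ fun i : Fin d => ∑ j, |A i.succ j|]
    have h3 : ∀ i : Fin d, |u i * A i.succ j| ≤ (∑ j, |A i.succ j|) * r := fun i => by
      rw [abs_mul, mul_comm]
      exact mul_le_mul (Finset.single_le_sum (f := fun j => |A i.succ j|)
        (fun _ _ => abs_nonneg _) (Finset.mem_univ j)) (hui i) (abs_nonneg _)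
        (Finset.sum_nonneg fun _ _ => abs_nonneg _)
    refine (Finset.sum_le_sum fun i _ => h3 i).trans (le_add_of_nonneg_left ?_)
    exact mul_nonneg (Finset.sum_nonneg fun _ _ => abs_nonneg _) hr.le
  have h4 : (((fun i => ((Fin.cons (q : ℤ) fun i => k (Fin.castAdd m i) :
      Fin (d + 1) → ℤ) i : ℝ)) ᵥ* A + affineShift A θ) j - k (Fin.natAdd d j)) =
      (q * (A 0 j + ∑ i, x i * A i.succ j) - θ (Fin.natAdd d j) - k (Fin.natAdd d j)) -
        ∑ i, u i * A i.succ j := by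
    simp only [Pi.add_apply, affineShift, Matrix.vecMul, dotProduct, Fin.sum_univ_succ,
      Fin.cons_zero, Fin.cons_succ, hu, sub_mul, add_mul, Finset.sum_sub_distrib,
      Finset.sum_add_distrib, mul_add, Finset.mul_sum, mul_assoc]
    push_cast
    ring
  rw [h4]
  refine (abs_sub _ _).trans ?_
  linarith

/-- The convergence Borel–Cantelli argument: a bound for the number of rational points near the
affine subspace shows that almost no point of it is `q^{-τ}`-approximable. -/
theorem volume_preimage_powerApproximableSet_eq_zero {d m : ℕ}
    (A : Matrix (Fin (d + 1)) (Fin m) ℝ) (θ : EuclideanSpace ℝ (Fin (d + m))) {τ s : ℝ}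
    (hτ : -1 < τ) (hs : s < d * (τ + 1))
    (hcount : ∀ (β : Fin m → ℝ) (C₀ : ℝ), 0 < C₀ → ∃ C : ℝ, ∀ᶠ Q : ℕ in Filter.atTop,
      ∀ P : Finset (Fin (d + 1) → ℤ), (∀ v ∈ P, ∀ i, |v i| ≤ Q) →
        (∀ v ∈ P, nearestIntDist ((fun i => (v i : ℝ)) ᵥ* A + β) ≤ C₀ * (Q : ℝ) ^ (-τ)) →
        (P.card : ℝ) ≤ C * (Q : ℝ) ^ s) :
    volume (affineParam A ⁻¹' powerApproximableSet τ θ) = 0 := by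
  classical
  -- restrict to a cube, and group the denominators `q` dyadically
  suffices hR : ∀ R : ℕ, volume (affineParam A ⁻¹' powerApproximableSet τ θ ∩
      {x | ∀ i, |x i| ≤ R}) = 0 by
    refine measure_mono_null ?_ (measure_iUnion_null hR)
    intro x hx
    obtain ⟨R, hR⟩ := exists_nat_ge ‖x‖
    exact Set.mem_iUnion.2 ⟨R, hx, fun i => (norm_le_pi_norm x i).trans hR⟩
  intro R
  obtain ⟨t, ht⟩ := exists_nat_ge ‖θ‖
  set M : ℕ := 2 * (R + t + 1) with hM
  have hM0 : (0 : ℝ) < M := by rw [hM]; positivity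
  set C₁ : ℝ := 1 + ∑ i, ∑ j, |A i j| with hC₁
  have hC₁0 : 0 < C₁ := add_pos_of_pos_of_nonneg one_pos
    (Finset.sum_nonneg fun _ _ => Finset.sum_nonneg fun _ _ => abs_nonneg _)
  set C₀ : ℝ := C₁ * ((2 : ℝ) ^ |τ| * (M : ℝ) ^ τ) with hC₀
  have hC₀0 : 0 < C₀ := by positivity
  obtain ⟨C, hC⟩ := hcount (affineShift A θ) C₀ hC₀0
  have hMt : Filter.Tendsto (fun k : ℕ => M * 2 ^ k) Filter.atTop Filter.atTop :=
    Filter.Tendsto.const_mul_atTop' (by rw [hM]; positivity)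
      (tendsto_pow_atTop_atTop_of_one_lt one_lt_two)
  obtain ⟨k₀, hk₀⟩ := Filter.eventually_atTop.1 (hMt.eventually hC)
  let P : ℕ → Finset (Fin (d + 1) → ℤ) := fun k =>
    (Fintype.piFinset fun _ => Finset.Icc (-((M * 2 ^ k : ℕ) : ℤ)) (M * 2 ^ k : ℕ)).filter
      fun v => nearestIntDist ((fun i => (v i : ℝ)) ᵥ* A + affineShift A θ) ≤
        C₀ * ((M * 2 ^ k : ℕ) : ℝ) ^ (-τ)
  let ctr : (Fin (d + 1) → ℤ) → Fin d → ℝ := fun v i =>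
    (v i.succ + θ (Fin.castAdd m i)) / v 0
  let rad : ℕ → ℝ := fun k => ((2 : ℝ) ^ k) ^ (-(τ + 1))
  let E : ℕ → Set (Fin d → ℝ) := fun k => ⋃ v ∈ P k, Metric.closedBall (ctr v) (rad k)
  have hrad0 : ∀ k, 0 ≤ rad k := fun k => by positivity
  have hPcard : ∀ k, k₀ ≤ k → ((P k).card : ℝ) ≤ C * ((M * 2 ^ k : ℕ) : ℝ) ^ s := by
    intro k hk
    refine hk₀ k hk (P k) (fun v hv i => ?_) fun v hv => (Finset.mem_filter.1 hv).2
    exact abs_le.2 (Finset.mem_Icc.1 (Fintype.mem_piFinset.1 (Finset.mem_filter.1 hv).1 i))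
  set a : ℝ := 2 ^ (s - d * (τ + 1)) with ha
  have ha0 : 0 < a := by positivity
  have ha1 : a < 1 := Real.rpow_lt_one_of_one_lt_of_neg one_lt_two (by linarith)
  have hvol : ∀ k, volume {x | k₀ ≤ k ∧ x ∈ E k} ≤
      ENNReal.ofReal (C * (M : ℝ) ^ s * 2 ^ d * a ^ k) := by
    intro k
    by_cases hk : k₀ ≤ k
    swap
    · simp [hk]
    calc volume {x | k₀ ≤ k ∧ x ∈ E k} ≤ volume (E k) := measure_mono fun x hx => hx.2
      _ ≤ ∑ v ∈ P k, volume (Metric.closedBall (ctr v) (rad k)) := measure_biUnion_finset_le _ _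
      _ = ENNReal.ofReal ((P k).card * (2 * rad k) ^ d) := by
          simp_rw [Real.volume_pi_closedBall _ (hrad0 k), Fintype.card_fin]
          rw [Finset.sum_const, nsmul_eq_mul, ENNReal.ofReal_mul (by positivity),
            ENNReal.ofReal_natCast]
      _ ≤ ENNReal.ofReal (C * ((M * 2 ^ k : ℕ) : ℝ) ^ s * (2 * rad k) ^ d) :=
          ENNReal.ofReal_le_ofReal (mul_le_mul_of_nonneg_right (hPcard k hk)
            (pow_nonneg (mul_nonneg zero_le_two (hrad0 k)) _))
      _ = _ := by
          congr 1
          push_cast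
          rw [Real.mul_rpow hM0.le (by positivity), mul_pow, ← Real.rpow_mul_natCast (by positivity),
            ← Real.rpow_natCast 2 k, ← Real.rpow_mul zero_le_two, ← Real.rpow_mul zero_le_two, ha,
            ← Real.rpow_mul_natCast zero_le_two]
          have : (2 : ℝ) ^ ((s - d * (τ + 1)) * k) =
              2 ^ (k * s) * 2 ^ (k * (-(τ + 1) * d)) := by
            rw [← Real.rpow_add two_pos]; congr 1; ring
          rw [this]; ring
  have hsum : ∑' k, volume {x | k₀ ≤ k ∧ x ∈ E k} ≠ ⊤ := by
    refine ne_top_of_le_ne_top ?_ (ENNReal.tsum_le_tsum hvol)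
    exact Summable.tsum_ofReal_ne_top
      ((summable_geometric_of_lt_one ha0.le ha1).mul_left _)
  refine measure_mono_null ?_ (measure_setOfPred_frequently_eq_zero hsum)
  rintro x ⟨hx, hxR⟩
  refine Filter.Frequently.and_eventually ?_ (Filter.eventually_ge_atTop k₀) |>.mono
    fun k hk => ⟨hk.2, hk.1⟩
  refine Filter.frequently_atTop.2 fun k₁ => ?_
  obtain ⟨q, ⟨hq0, hq⟩, hqk⟩ := Set.Infinite.exists_gt hx (2 ^ k₁)
  beta_reduce at hq
  refine ⟨Nat.log 2 q, Nat.le_log_of_pow_le one_lt_two hqk.le, ?_⟩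
  set k := Nat.log 2 q with hk
  have hk1 : (2 : ℝ) ^ k ≤ q := by exact_mod_cast Nat.pow_log_le_self 2 hq0.ne'
  have hk2 : (q : ℝ) ≤ 2 ^ (k + 1) := by
    exact_mod_cast (Nat.lt_pow_succ_log_self one_lt_two q).le
  have hq0' : (0 : ℝ) < q := by exact_mod_cast hq0
  have hq1 : (1 : ℝ) ≤ q := by exact_mod_cast hq0
  have hk0 : (0 : ℝ) < 2 ^ k := by positivity
  obtain ⟨v, hv0, hvx, hvA⟩ := exists_intVec_of_nearestIntDist_lt A θ hq
  have hqτ : (q : ℝ) ^ (-τ) ≤ q := by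
    conv_rhs => rw [← Real.rpow_one (q : ℝ)]
    exact Real.rpow_le_rpow_of_exponent_le hq1 (by linarith)
  refine Set.mem_biUnion (x := v) ?_ ?_
  · refine Finset.mem_coe.2 (Finset.mem_filter.2 ⟨Fintype.mem_piFinset.2 fun i => ?_, ?_⟩)
    · rw [Finset.mem_Icc, ← abs_le]
      have hreal : |(v i : ℝ)| ≤ ((M * 2 ^ k : ℕ) : ℝ) := by
        have hq' : (q : ℝ) * (R + t + 1) ≤ ((M * 2 ^ k : ℕ) : ℝ) := by
          push_cast [hM]
          rw [pow_succ] at hk2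
          have : (0 : ℝ) ≤ R + t + 1 := by positivity
          nlinarith
        refine Fin.cases ?_ (fun i => ?_) i
        · rw [hv0, Int.cast_natCast, Nat.abs_cast]
          have : (0 : ℝ) ≤ R + t := by positivity
          nlinarith
        · have h1 := hvx i
          have h2 : |q * x i| ≤ q * R := by
            rw [abs_mul, Nat.abs_cast]; gcongr; exact hxR i
          have h3 : |θ (Fin.castAdd m i)| ≤ t := (PiLp.norm_apply_le θ _).trans ht
          have h4 : (t : ℝ) ≤ q * t := le_mul_of_one_le_left (by positivity) hq1
          rw [abs_le] at h1 h2 h3 ⊢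
          constructor <;> linarith
      exact_mod_cast hreal
    · refine hvA.trans ?_
      rw [hC₀, mul_assoc]
      refine mul_le_mul_of_nonneg_left ?_ hC₁0.le
      push_cast
      rw [Real.mul_rpow hM0.le hk0.le, Real.rpow_neg hM0.le]
      have e : 2 ^ |τ| * (M : ℝ) ^ τ * (((M : ℝ) ^ τ)⁻¹ * ((2 : ℝ) ^ k) ^ (-τ)) =
          2 ^ |τ| * ((2 : ℝ) ^ k) ^ (-τ) := by
        have : (M : ℝ) ^ τ ≠ 0 := by positivity
        field_simp
      rw [e]
      rcases le_total 0 τ with h0 | h0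
      · refine (Real.rpow_le_rpow_of_nonpos hk0 hk1 (by linarith)).trans
          (le_mul_of_one_le_left (by positivity) ?_)
        exact Real.one_le_rpow one_le_two (abs_nonneg _)
      · rw [abs_of_nonpos h0, ← Real.mul_rpow zero_le_two hk0.le]
        refine Real.rpow_le_rpow hq0'.le ?_ (by linarith)
        rw [← pow_succ']; exact hk2
  · rw [Metric.mem_closedBall, dist_eq_norm]
    refine (pi_norm_le_iff_of_nonneg (hrad0 k)).2 fun i => ?_
    have h1 : (x - ctr v) i = (q * x i - (v i.succ + θ (Fin.castAdd m i))) / q := by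
      simp only [Pi.sub_apply, ctr, hv0, Int.cast_natCast]
      field_simp
    rw [h1, Real.norm_eq_abs, abs_div, Nat.abs_cast, div_le_iff₀ hq0']
    refine (hvx i).trans ?_
    have h2 : (q : ℝ) ^ (-τ) = q ^ (-(τ + 1)) * q := by
      rw [← Real.rpow_add_one hq0'.ne']; congr 1; ring
    rw [h2]
    gcongr
    exact Real.rpow_le_rpow_of_nonpos hk0 hk1 (by linarith)

/-! ### Almost everywhere non-approximability -/

theorem exists_gt_one_sub_div_lt {a w r : ℝ} (hw : 0 < w) (h : 1 - a / w < r) :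
    ∃ w', 1 - a / w' < r ∧ w < w' := by
  have hcont : ContinuousAt (fun x : ℝ => 1 - a / x) w :=
    continuousAt_const.sub (continuousAt_const.div continuousAt_id hw.ne')
  have h1 : ∀ᶠ x in nhdsWithin w (Set.Ioi w), 1 - a / x < r :=
    (hcont.eventually (gt_mem_nhds h)).filter_mono nhdsWithin_le_nhds
  exact (h1.and self_mem_nhdsWithin).exists

/-- Almost no point of the affine subspace is `q^{-τ}`-approximable once `τ > (1 - m / w) / d` for
some `w ≥ d + m` above `ω(A)`. -/
theorem volume_preimage_eq_zero_of_diophantineExponent_lt {d m : ℕ}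
    (A : Matrix (Fin (d + 1)) (Fin m) ℝ) (θ : EuclideanSpace ℝ (Fin (d + m))) {τ w : ℝ}
    (hd : 1 ≤ d) (hw : diophantineExponent A < w) (hwn : (d : ℝ) + m ≤ w)
    (hτ : 1 - m / w < d * τ) :
    volume (affineParam A ⁻¹' powerApproximableSet τ θ) = 0 := by
  have hd' : (1 : ℝ) ≤ d := by exact_mod_cast hd
  have hm' : (0 : ℝ) ≤ m := Nat.cast_nonneg m
  have hw0 : 0 < w := by linarith
  obtain ⟨w', hτ', hww'⟩ := exists_gt_one_sub_div_lt hw0 hτ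
  have hw'0 : 0 < w' := hw0.trans hww'
  have hτw : 1 / w' < τ := by
    have h1 : (1 - m / w') * w' = w' - m := by field_simp
    have h2 : w' - m < d * τ * w' := by
      rw [← h1]; exact mul_lt_mul_of_pos_right hτ' hw'0
    rw [div_lt_iff₀ hw'0]
    by_contra! hc
    nlinarith
  have hτ0 : 0 < τ := lt_trans (by positivity) hτw
  refine volume_preimage_powerApproximableSet_eq_zero A θ (s := d + 1 - m / w') (by linarith)
    (by linarith) fun β C₀ hC₀ => ?_
  -- frequencies up to `Q^{1/w'}` with `w' > w` leave `‖A h‖` larger than `1 / Q` by a power of `Q`,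
  -- and `k` is the number of averages for which this power beats the loss
  obtain ⟨c, hc, hcA⟩ := exists_mul_rpow_le_nearestIntDist A hw
  set e : ℝ := 1 - w / w' with he
  have he0 : 0 < e := by rw [he, sub_pos, div_lt_one hw'0]; exact hww'
  obtain ⟨k, hk⟩ := exists_nat_ge (m / w' / e)
  rw [div_le_iff₀ he0] at hk
  set c' : ℝ := 2 * (c * 2 ^ (-w)) with hc'
  have hc'0 : 0 < c' := by positivity
  refine ⟨4 ^ m * (k + 3) ^ (d + 1) * (1 + (1 / c') ^ k), ?_⟩
  have hev : ∀ᶠ Q : ℕ in Filter.atTop,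
      (Q : ℝ) ^ (-(τ - 1 / w')) < 1 / (8 * Real.pi * C₀) :=
    ((tendsto_rpow_neg_atTop (sub_pos.2 hτw)).comp tendsto_natCast_atTop_atTop).eventually
      (gt_mem_nhds (by have := Real.pi_pos; positivity))
  filter_upwards [hev, Filter.eventually_ge_atTop 1] with Q hQ hQ1 P hP hPA
  have hQ0 : (0 : ℝ) < Q := by exact_mod_cast hQ1
  have hQ1' : (1 : ℝ) ≤ Q := by exact_mod_cast hQ1
  set y : ℝ := (Q : ℝ) ^ (1 / w') with hy
  have hy1 : 1 ≤ y := Real.one_le_rpow hQ1' (by positivity)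
  set H : ℕ := ⌈y⌉₊ with hH
  have hH0 : 0 < H := Nat.ceil_pos.2 (by linarith)
  have hyH : y ≤ H := Nat.le_ceil y
  have hHy : (H : ℝ) ≤ 2 * y := by
    have := Nat.ceil_lt_add_one (by linarith : 0 ≤ y); linarith
  have hH0' : (0 : ℝ) < H := by exact_mod_cast hH0
  set ρ : ℝ := c * 2 ^ (-w) * (Q : ℝ) ^ (-(w / w')) with hρ
  have hρ0 : 0 < ρ := by positivity
  have hAh : ∀ h : Fin m → ℤ, h ≠ 0 → (∀ j, |h j| < H) →
      ρ ≤ nearestIntDist (A *ᵥ fun j => (h j : ℝ)) := by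
    intro h hh hhH
    refine le_trans ?_ (hcA h hh)
    rw [hρ, mul_assoc]
    refine mul_le_mul_of_nonneg_left ?_ hc.le
    have h1 : (2 : ℝ) ^ (-w) * (Q : ℝ) ^ (-(w / w')) = (2 * y) ^ (-w) := by
      rw [Real.mul_rpow zero_le_two (by positivity), hy, ← Real.rpow_mul hQ0.le]
      congr 2; ring
    rw [h1]
    refine Real.rpow_le_rpow_of_nonpos (lt_of_lt_of_le one_pos (one_le_norm_intCast hh)) ?_
      (by linarith)
    refine le_trans ((pi_norm_le_iff_of_nonneg hH0'.le).2 fun j => ?_) hHy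
    rw [Real.norm_eq_abs]
    exact_mod_cast (hhH j).le
  have hδ : C₀ * (Q : ℝ) ^ (-τ) ≤ 1 / (4 * Real.pi * H) := by
    have hpi := Real.pi_pos
    have h1 : (Q : ℝ) ^ (-τ) = Q ^ (-(τ - 1 / w')) * y⁻¹ := by
      rw [hy, ← Real.rpow_neg hQ0.le, ← Real.rpow_add hQ0]; congr 1; ring
    rw [h1]
    calc C₀ * ((Q : ℝ) ^ (-(τ - 1 / w')) * y⁻¹)
        ≤ C₀ * (1 / (8 * Real.pi * C₀) * y⁻¹) := by gcongr
      _ = 1 / (4 * Real.pi * (2 * y)) := by field_simp; norm_num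
      _ ≤ _ := by gcongr
  have hmain := card_nearestIntDist_vecMul_add_le A β k hH0 hQ1 hρ0 hAh P hP
    fun v hv => (hPA v hv).trans hδ
  rw [Fintype.card_fin, Fintype.card_fin] at hmain
  refine hmain.trans ?_
  have hb1 : 1 / (H : ℝ) ^ m ≤ (Q : ℝ) ^ (-(m / w')) := by
    have : (Q : ℝ) ^ (-(m / w')) = 1 / y ^ m := by
      rw [hy, ← Real.rpow_mul_natCast hQ0.le, one_div, ← Real.rpow_neg hQ0.le]; congr 1; ring
    rw [this]; gcongr
  have hb2 : (1 / (2 * ρ * Q)) ^ k ≤ (1 / c') ^ k * (Q : ℝ) ^ (-(m / w')) := by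
    have h1 : 2 * ρ * Q = c' * (Q : ℝ) ^ e := by
      rw [hρ, hc', he, sub_eq_neg_add, Real.rpow_add_one hQ0.ne']; ring
    have h2 : (1 / (c' * (Q : ℝ) ^ e)) ^ k = (1 / c') ^ k * (Q : ℝ) ^ (-(k * e)) := by
      rw [one_div, mul_inv, mul_pow, ← Real.rpow_neg hQ0.le, ← Real.rpow_mul_natCast hQ0.le,
        one_div]
      congr 2; ring
    rw [h1, h2]
    gcongr
  calc (4 : ℝ) ^ m * ((k + 3) * Q) ^ (d + 1) * (1 / (H : ℝ) ^ m + (1 / (2 * ρ * Q)) ^ k)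
      ≤ (4 : ℝ) ^ m * ((k + 3) * Q) ^ (d + 1) *
        ((Q : ℝ) ^ (-(m / w')) + (1 / c') ^ k * (Q : ℝ) ^ (-(m / w'))) := by gcongr
    _ = _ := by
      have : (Q : ℝ) ^ ((d : ℝ) + 1 - m / w') = Q ^ (d + 1) * (Q : ℝ) ^ (-(m / w')) := by
        rw [← Real.rpow_natCast, ← Real.rpow_add hQ0]; push_cast; congr 1
      rw [this, mul_pow ((k : ℝ) + 3)]; ring

/-- Almost no point of the affine subspace is `q^{-τ}`-approximable once `τ > 1 / d`, by the trivial
count of rational points. -/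
theorem volume_preimage_eq_zero_of_one_lt_mul {d m : ℕ}
    (A : Matrix (Fin (d + 1)) (Fin m) ℝ) (θ : EuclideanSpace ℝ (Fin (d + m))) {τ : ℝ}
    (hd : 1 ≤ d) (hτ : 1 < d * τ) :
    volume (affineParam A ⁻¹' powerApproximableSet τ θ) = 0 := by
  classical
  have hd' : (1 : ℝ) ≤ d := by exact_mod_cast hd
  have hτ0 : -1 < τ := by by_contra! hc; nlinarith
  refine volume_preimage_powerApproximableSet_eq_zero A θ (s := d + 1) hτ0
    (by linarith) fun β C₀ _ => ⟨3 ^ (d + 1), ?_⟩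
  filter_upwards [Filter.eventually_ge_atTop 1] with Q hQ1 P hP _
  have hQ1' : (1 : ℝ) ≤ Q := by exact_mod_cast hQ1
  have h1 : P ⊆ Fintype.piFinset fun _ => Finset.Icc (-(Q : ℤ)) Q := fun v hv =>
    Fintype.mem_piFinset.2 fun i => Finset.mem_Icc.2 (abs_le.1 (hP v hv i))
  have h2 := Finset.card_le_card h1
  rw [Fintype.card_piFinset, Finset.prod_const, Int.card_Icc, Finset.card_univ,
    Fintype.card_fin] at h2
  have h3 : ((Q : ℤ) + 1 - -Q).toNat = 2 * Q + 1 := by omega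
  rw [h3] at h2
  have h4 : (P.card : ℝ) ≤ (2 * Q + 1) ^ (d + 1) := by exact_mod_cast h2
  have h5 : (Q : ℝ) ^ ((d : ℝ) + 1) = Q ^ (d + 1) := by
    rw [← Real.rpow_natCast]; push_cast; rfl
  rw [h5, ← mul_pow]
  exact h4.trans (pow_le_pow_left₀ (by positivity) (by linarith) _)

/-- Almost no point of the affine subspace is `q^{-τ}`-approximable once
`τ > (m w - d) / (d + m)` for some `w ≥ 0` above `σ(A)`. -/
theorem volume_preimage_eq_zero_of_dualDiophantineExponent_lt {d m : ℕ}
    (A : Matrix (Fin (d + 1)) (Fin m) ℝ) (θ : EuclideanSpace ℝ (Fin (d + m))) {τ w : ℝ}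
    (hd : 1 ≤ d) (hw : dualDiophantineExponent A < w) (hw0 : 0 ≤ w)
    (hτ1 : -1 < τ) (hτ : m * w - d < (d + m) * τ) :
    volume (affineParam A ⁻¹' powerApproximableSet τ θ) = 0 := by
  have hd' : (1 : ℝ) ≤ d := by exact_mod_cast hd
  have hs : m * max (w - τ) 0 < d * (τ + 1) := by
    rcases max_cases (w - τ) 0 with h | h <;> rw [h.1] <;> nlinarith
  refine volume_preimage_powerApproximableSet_eq_zero A θ hτ1 hs fun β C₀ hC₀ => ?_
  obtain ⟨c, hc, hcA⟩ := exists_mul_rpow_le_nearestIntDist Aᵀ hw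
  set C' : ℝ := C₀ / (c * 2 ^ (-w)) with hC'
  have hC'0 : 0 < C' := by positivity
  refine ⟨(2 * C' + 2) ^ m, ?_⟩
  filter_upwards [Filter.eventually_ge_atTop 1] with Q hQ1 P hP hPA
  have hQ0 : (0 : ℝ) < Q := by exact_mod_cast hQ1
  have hQ1' : (1 : ℝ) ≤ Q := by exact_mod_cast hQ1
  set ρ : ℝ := c * (2 * Q) ^ (-w) with hρ
  have hρ0 : 0 < ρ := by positivity
  have hsep : ∀ v : Fin (d + 1) → ℤ, v ≠ 0 → (∀ i, |v i| ≤ 2 * (Q : ℤ)) →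
      ρ ≤ nearestIntDist ((fun i => (v i : ℝ)) ᵥ* A) := by
    intro v hv hvQ
    have h1 := hcA v hv
    rw [Matrix.mulVec_transpose] at h1
    refine le_trans (mul_le_mul_of_nonneg_left ?_ hc.le) h1
    refine Real.rpow_le_rpow_of_nonpos (lt_of_lt_of_le one_pos (one_le_norm_intCast hv)) ?_
      (by linarith)
    refine (pi_norm_le_iff_of_nonneg (by positivity)).2 fun i => ?_
    rw [Real.norm_eq_abs]
    exact_mod_cast hvQ i
  have hmain := card_le_of_separated A β hρ0 (by positivity) hsep P hP hPA
  rw [Fintype.card_fin] at hmain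
  have h1 : C₀ * (Q : ℝ) ^ (-τ) / ρ = C' * (Q : ℝ) ^ (w - τ) := by
    rw [hρ, hC', Real.mul_rpow zero_le_two hQ0.le, sub_eq_neg_add, Real.rpow_add hQ0,
      Real.rpow_neg hQ0.le w]
    have : (Q : ℝ) ^ w ≠ 0 := by positivity
    field_simp
  rw [h1] at hmain
  have h2 : (Q : ℝ) ^ (w - τ) ≤ Q ^ max (w - τ) 0 :=
    Real.rpow_le_rpow_of_exponent_le hQ1' (le_max_left _ _)
  have h3 : 1 ≤ (Q : ℝ) ^ max (w - τ) 0 := Real.one_le_rpow hQ1' (le_max_right _ _)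
  have h4 : (Q : ℝ) ^ (m * max (w - τ) 0) = ((Q : ℝ) ^ max (w - τ) 0) ^ m := by
    rw [← Real.rpow_mul_natCast hQ0.le, mul_comm]
  rw [h4, ← mul_pow]
  refine hmain.trans (pow_le_pow_left₀ (by positivity) ?_ _)
  nlinarith

/-! ### Inhomogeneous transference -/

/-- A point at distance at least `2 J` from a subgroup `Λ` of a normed space gives `J + 1` points
of norm at most `2 J` whose translates by `Λ` are pairwise `1`-separated: place them on the
segment from an almost nearest point of `Λ`, which is almost a geodesic modulo `Λ`. -/
theorem exists_separated_points_of_far {E : Type*} [NormedAddCommGroup E] [NormedSpace ℝ E]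
    (Λ : AddSubgroup E) (t : E) {J : ℕ} (hJ : ∀ x ∈ Λ, (2 * J : ℝ) ≤ ‖t - x‖) :
    ∃ p : ℕ → E, (∀ j ≤ J, ‖p j‖ ≤ 2 * J) ∧
      ∀ i ≤ J, ∀ j ≤ J, i ≠ j → ∀ x ∈ Λ, 1 ≤ ‖p i - p j - x‖ := by
  rcases Nat.eq_zero_or_pos J with rfl | hJ0
  · refine ⟨fun _ => 0, by simp, fun i hi j hj hij => absurd ?_ hij⟩
    omega
  have hJ0' : (0 : ℝ) < J := by exact_mod_cast hJ0
  obtain ⟨x₀, hx₀, hmin⟩ : ∃ x₀ ∈ Λ, ∀ x ∈ Λ, ‖t - x₀‖ - 1 < ‖t - x‖ := by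
    set D := ⨅ x : Λ, ‖t - x‖ with hD
    have hbdd : BddBelow (Set.range fun x : Λ => ‖t - x‖) :=
      ⟨0, by rintro _ ⟨x, rfl⟩; exact norm_nonneg _⟩
    obtain ⟨x₀, hx₀⟩ := exists_lt_of_ciInf_lt (f := fun x : Λ => ‖t - x‖)
      (lt_add_one D)
    refine ⟨x₀, x₀.2, fun x hx => ?_⟩
    have := ciInf_le hbdd ⟨x, hx⟩
    simp only at this hx₀
    linarith
  set v := t - x₀ with hv
  set L := ‖v‖ with hL
  have hJL : 2 * (J : ℝ) ≤ L := hJ x₀ hx₀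
  have hL0 : 0 < L := by linarith
  set p : ℕ → E := fun j => (2 * j / L : ℝ) • v with hp
  have key : ∀ i ≤ J, ∀ j < i, ∀ x ∈ Λ, 1 ≤ ‖p i - p j - x‖ := by
    intro i hi j hj x hx
    have h1 := hmin (x₀ + x) (Λ.add_mem hx₀ hx)
    have h2 : t - (x₀ + x) = (v - (p i - p j)) + (p i - p j - x) := by
      rw [hv]; abel
    have hij : (j : ℝ) + 1 ≤ i := by exact_mod_cast hj
    have hiJ : (i : ℝ) ≤ J := by exact_mod_cast hi
    have h3 : ‖v - (p i - p j)‖ = L - 2 * (i - j) := by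
      have : v - (p i - p j) = (1 - 2 * (i - j) / L : ℝ) • v := by
        simp only [hp, ← sub_smul]
        rw [← one_smul ℝ v, smul_smul, smul_smul, ← sub_smul]
        congr 1; ring
      have hj0 : (0 : ℝ) ≤ j := Nat.cast_nonneg j
      rw [this, norm_smul, Real.norm_of_nonneg, ← hL]
      · field_simp
      · rw [sub_nonneg, div_le_one hL0]; linarith
    have h4 := norm_add_le (v - (p i - p j)) (p i - p j - x)
    rw [← h2, h3] at h4
    linarith
  refine ⟨p, fun j hj => ?_, fun i hi j hj hij x hx => ?_⟩
  · have hjJ : (j : ℝ) ≤ J := by exact_mod_cast hj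
    rw [hp, norm_smul, Real.norm_of_nonneg (by positivity), ← hL, div_mul_cancel₀ _ hL0.ne']
    linarith
  · rcases lt_or_gt_of_ne hij with h | h
    · have := key j hj i h (-x) (Λ.neg_mem hx)
      have e : p i - p j - x = -(p j - p i - -x) := by abel
      rw [e, norm_neg]; exact this
    · exact key i hi j h x hx

/-- The lattice of the points `(q / N, (q y - p) / δ)` with `q` and `p` integral. -/
noncomputable def approxLattice {ι : Type*} (y : ι → ℝ) (N δ : ℝ) : AddSubgroup (ℝ × (ι → ℝ)) where
  carrier := Set.range fun a : ℤ × (ι → ℤ) => ((a.1 : ℝ) / N, fun i => (a.1 * y i - a.2 i) / δ)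
  add_mem' := by
    rintro _ _ ⟨a, rfl⟩ ⟨b, rfl⟩
    refine ⟨a + b, ?_⟩
    ext
    · simp [add_div]
    · simp; ring
  zero_mem' := ⟨0, by ext <;> simp⟩
  neg_mem' := by
    rintro _ ⟨a, rfl⟩
    refine ⟨-a, ?_⟩
    ext
    · simp [neg_div]
    · simp; ring

/-- Inhomogeneous transference: if `|q| < N`, `|q y - p| < δ` has no nonzero integer solution, then
every point is within `R` times these bounds of some `(q, q y - p)`, with an explicit `R`
comparable to `1 + 1 / (N δⁿ)`. -/
theorem exists_inhomogeneous_approx {ι : Type*} [Fintype ι] (y : ι → ℝ) {N δ : ℝ} (hN : 1 ≤ N)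
    (hδ : 0 < δ) (hδ1 : δ ≤ 1)
    (hno : ∀ (q : ℤ) (p : ι → ℤ), (q ≠ 0 ∨ p ≠ 0) → |(q : ℝ)| < N → ∃ i, δ ≤ |q * y i - p i|)
    (t : ℝ) (θ : ι → ℝ) :
    ∃ (q : ℤ) (p : ι → ℤ),
      |t - q| ≤ 2 * (7 * (2 / δ) ^ Fintype.card ι / N + 1) * N ∧
      ∀ i, |θ i - (q * y i - p i)| ≤ 2 * (7 * (2 / δ) ^ Fintype.card ι / N + 1) * δ := by
  classical
  have hN0 : 0 < N := by linarith
  set W : ℝ := 7 * (2 / δ) ^ Fintype.card ι / N with hW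
  have hW0 : 0 < W := by positivity
  by_contra! hcon
  set Λ := approxLattice y N δ with hΛ
  have hfar : ∀ x ∈ Λ, 2 * (W + 1) ≤ ‖(t / N, fun i => θ i / δ) - x‖ := by
    rintro _ ⟨a, rfl⟩
    by_contra! hlt
    rw [Prod.norm_def, max_lt_iff] at hlt
    have h1 : |t - a.1| < 2 * (W + 1) * N := by
      have := hlt.1
      simp only [Prod.fst_sub, ← sub_div, Real.norm_eq_abs] at this
      rwa [abs_div, abs_of_pos hN0, div_lt_iff₀ hN0] at this
    obtain ⟨i, hi⟩ := hcon a.1 a.2 h1.le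
    have h2 := (norm_le_pi_norm _ i).trans_lt hlt.2
    simp only [Prod.snd_sub, Pi.sub_apply, ← sub_div, Real.norm_eq_abs] at h2
    rw [abs_div, abs_of_pos hδ, div_lt_iff₀ hδ] at h2
    linarith
  set J : ℕ := ⌊W + 1⌋₊ with hJ
  have hJ1 : 1 ≤ J := Nat.le_floor (by push_cast; linarith)
  have hJW : W < J := by
    have := Nat.lt_floor_add_one (W + 1); linarith
  have hJW' : (J : ℝ) ≤ W + 1 := Nat.floor_le (by linarith)
  have hJ1' : (1 : ℝ) ≤ J := by exact_mod_cast hJ1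
  obtain ⟨p, hp, hsep⟩ := exists_separated_points_of_far Λ (t / N, fun i => θ i / δ) (J := J)
    fun x hx => by linarith [hfar x hx]
  set T : ℕ := ⌈J * N⌉₊ with hT
  have hTl : (J : ℝ) * N ≤ T := Nat.le_ceil _
  have hTu : (T : ℝ) < J * N + 1 := Nat.ceil_lt_add_one (by positivity)
  -- the translate of `p j` by the lattice vector with first index `q`, reduced modulo `ℤ^ι`
  set k : ℕ × ℕ → ι → ℤ := fun a i => ⌊(p a.1).2 i * δ + a.2 * y i⌋ with hk
  set f : ℕ × ℕ → ℝ × (ι → ℝ) := fun a =>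
    p a.1 + ((a.2 : ℝ) / N, fun i => ((a.2 : ℝ) * y i - k a i) / δ) with hf
  set c : ℕ × ℕ → ℤ × (ι → ℤ) := fun a => (⌊(f a).1⌋, fun i => ⌊(f a).2 i⌋) with hc
  set S : Finset (ℕ × ℕ) := Finset.range (J + 1) ×ˢ Finset.range T with hS
  set B : Finset (ℤ × (ι → ℤ)) := Finset.Icc (-(2 * J : ℤ)) (3 * J + 1) ×ˢ
    Fintype.piFinset (fun _ => Finset.Icc 0 ⌊1 / δ⌋) with hB
  have hmaps : Set.MapsTo c S B := by
    intro a ha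
    obtain ⟨ha1, ha2⟩ := Finset.mem_product.1 (Finset.mem_coe.1 ha)
    rw [Finset.mem_range] at ha1 ha2
    refine Finset.mem_coe.2 (Finset.mem_product.2 ⟨Finset.mem_Icc.2 ?_,
      Fintype.mem_piFinset.2 fun i => Finset.mem_Icc.2 ?_⟩)
    · have h1 : |(p a.1).1| ≤ 2 * J :=
        (norm_fst_le (p a.1)).trans (hp a.1 (by omega))
      have h2 := abs_le.1 h1
      have h3 : (a.2 : ℝ) ≤ J * N + 1 := by
        have : (a.2 : ℝ) ≤ T := by exact_mod_cast ha2.le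
        linarith
      have h4 : (a.2 : ℝ) / N ≤ J + 1 := by
        rw [div_le_iff₀ hN0]; nlinarith
      have h5 : 0 ≤ (a.2 : ℝ) / N := by positivity
      simp only [hc, hf, Prod.fst_add]
      constructor
      · rw [Int.le_floor]; push_cast; linarith
      · have h6 : (p a.1).1 + (a.2 : ℝ) / N ≤ ((3 * J + 1 : ℤ) : ℝ) := by push_cast; linarith
        exact_mod_cast (Int.floor_le _).trans h6
    · have h1 : (f a).2 i = Int.fract ((p a.1).2 i * δ + a.2 * y i) / δ := by
        simp only [hf, Prod.snd_add, Pi.add_apply, hk, Int.fract]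
        field_simp
        ring
      have h2 := Int.fract_nonneg ((p a.1).2 i * δ + a.2 * y i)
      have h3 := (Int.fract_lt_one ((p a.1).2 i * δ + a.2 * y i)).le
      simp only [hc]
      rw [h1]
      exact ⟨Int.floor_nonneg.2 (by positivity), Int.floor_le_floor (by gcongr)⟩
  have hinj : Set.InjOn c S := by
    intro a ha b hb hab
    obtain ⟨ha1, ha2⟩ := Finset.mem_product.1 (Finset.mem_coe.1 ha)
    obtain ⟨hb1, hb2⟩ := Finset.mem_product.1 (Finset.mem_coe.1 hb)
    rw [Finset.mem_range] at ha1 ha2 hb1 hb2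
    have hclose : ‖f a - f b‖ < 1 := by
      rw [Prod.norm_def, max_lt_iff]
      refine ⟨Int.abs_sub_lt_one_of_floor_eq_floor (congrArg Prod.fst hab), ?_⟩
      exact (pi_norm_lt_iff one_pos).2 fun i =>
        Int.abs_sub_lt_one_of_floor_eq_floor (congrFun (congrArg Prod.snd hab) i)
    have hdiff : f a - f b = p a.1 - p b.1 -
        ((((b.2 : ℤ) - a.2 : ℤ) : ℝ) / N,
          fun i => ((((b.2 : ℤ) - a.2 : ℤ) : ℝ) * y i - ((k b i - k a i : ℤ) : ℝ)) / δ) := by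
      simp only [hf]
      ext
      · simp; ring
      · simp; ring
    by_cases h1 : a.1 = b.1
    · by_cases h2 : a.2 = b.2
      · exact Prod.ext h1 h2
      · exfalso
        have hq : (b.2 : ℤ) - a.2 ≠ 0 := by omega
        rw [hdiff, h1, sub_self, zero_sub, norm_neg, Prod.norm_def, max_lt_iff] at hclose
        have h3 := hclose.1
        simp only [Real.norm_eq_abs] at h3
        rw [abs_div, abs_of_pos hN0, div_lt_one hN0] at h3
        obtain ⟨i, hi⟩ := hno _ (fun i => k b i - k a i) (Or.inl hq) h3
        have h4 := (norm_le_pi_norm _ i).trans_lt hclose.2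
        simp only [Real.norm_eq_abs] at h4
        rw [abs_div, abs_of_pos hδ, div_lt_one hδ] at h4
        exact absurd hi (not_le.2 h4)
    · have h2 := hsep a.1 (by omega) b.1 (by omega) h1 _
        ⟨((b.2 : ℤ) - a.2, fun i => k b i - k a i), rfl⟩
      simp only at h2
      rw [hdiff] at hclose
      exact absurd h2 (not_le.2 hclose)
  have hcard := Finset.card_le_card_of_injOn c hmaps hinj
  have hScard : (S.card : ℝ) = (J + 1) * T := by
    rw [hS, Finset.card_product, Finset.card_range, Finset.card_range]; push_cast; ring
  have hfl : 0 ≤ ⌊1 / δ⌋ := Int.floor_nonneg.2 (by positivity)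
  have hBcard : (B.card : ℝ) ≤ (5 * J + 2) * (2 / δ) ^ Fintype.card ι := by
    rw [hB, Finset.card_product, Fintype.card_piFinset, Finset.prod_const, Int.card_Icc,
      Int.card_Icc, Finset.card_univ]
    have e1 : ((3 * J + 1 : ℤ) + 1 - -(2 * J : ℤ)).toNat = 5 * J + 2 := by omega
    have e2 : (((⌊1 / δ⌋ + 1 - 0).toNat : ℕ) : ℝ) ≤ 2 / δ := by
      rw [← Int.cast_natCast, Int.toNat_of_nonneg (by omega)]
      push_cast
      have h1 := Int.floor_le (1 / δ)
      have h2 : 1 ≤ 1 / δ := by rw [le_div_iff₀ hδ]; linarith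
      have h3 : 2 / δ = 1 / δ + 1 / δ := by ring
      linarith
    rw [e1]
    push_cast
    gcongr
  have hfinal : ((J : ℝ) + 1) * T ≤ (5 * J + 2) * (2 / δ) ^ Fintype.card ι := by
    rw [← hScard]
    exact le_trans (by exact_mod_cast hcard) hBcard
  have hWN : W * N = 7 * (2 / δ) ^ Fintype.card ι := by rw [hW]; field_simp
  have hY : 0 < (2 / δ) ^ Fintype.card ι := by positivity
  have h1 : ((J : ℝ) + 1) * (J * N) ≤ 7 * J * (2 / δ) ^ Fintype.card ι := by
    refine (mul_le_mul_of_nonneg_left hTl (by positivity)).trans (hfinal.trans ?_)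
    gcongr
    linarith
  have h2 : ((J : ℝ) + 1) * (J * N) ≤ W * (J * N) := by
    rw [show W * (J * N) = J * (W * N) by ring, hWN]; linarith
  have h3 := le_of_mul_le_mul_right h2 (by positivity)
  linarith

theorem powerApproximableSet_mono {n : ℕ} {τ τ' : ℝ} (h : τ ≤ τ') (θ : EuclideanSpace ℝ (Fin n)) :
    powerApproximableSet τ' θ ⊆ powerApproximableSet τ θ := by
  intro y hy
  refine Set.Infinite.mono ?_ hy
  rintro q ⟨hq0, hq⟩
  refine ⟨hq0, hq.trans_le ?_⟩
  exact Real.rpow_le_rpow_of_exponent_le (by exact_mod_cast hq0) (by linarith)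

/-- A point that is not very well approximable satisfies, for every shift, the inhomogeneous
approximation property with any exponent below `1 / n`. -/
theorem mem_powerApproximableSet_of_not_very_well_approximable {n : ℕ} (hn : 1 ≤ n)
    (y : EuclideanSpace ℝ (Fin n)) (hy : ∀ τ : ℝ, 1 / (n : ℝ) < τ → y ∉ powerApproximableSet τ 0)
    (θ : EuclideanSpace ℝ (Fin n)) {τ : ℝ} (hτ : τ < 1 / n) :
    y ∈ powerApproximableSet τ θ := by
  have hn' : (1 : ℝ) ≤ n := by exact_mod_cast hn
  have hn0 : (0 : ℝ) < n := by linarith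
  wlog hτ0 : 0 ≤ τ generalizing τ
  · exact powerApproximableSet_mono (not_le.1 hτ0).le θ (this (by positivity) le_rfl)
  set ε : ℝ := (1 / n - τ) / (2 * n) with hε
  have hε0 : 0 < ε := div_pos (sub_pos.2 hτ) (by positivity)
  set τ₁ : ℝ := 1 / n + ε with hτ₁
  have hτ₁0 : 0 < τ₁ := by positivity
  -- `y` as a one-column matrix
  obtain ⟨c, hc, hcy⟩ : ∃ c : ℝ, 0 < c ∧ ∀ q : Fin 1 → ℤ, q ≠ 0 → c * ‖fun j => (q j : ℝ)‖ ^ (-τ₁) ≤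
      nearestIntDist ((Matrix.of fun (i : Fin n) (_ : Fin 1) => y i) *ᵥ fun j => (q j : ℝ)) := by
    refine exists_mul_rpow_le_nearestIntDist_of_finite _ ?_
    have hfin : {q : ℕ | 0 < q ∧ nearestIntDist (fun i => (q : ℝ) * y i -
        (0 : EuclideanSpace ℝ (Fin n)) i) < (q : ℝ) ^ (-τ₁)}.Finite :=
      Set.not_infinite.1 (hy τ₁ (by linarith))
    refine (((hfin.insert 0).image fun a : ℕ => fun _ : Fin 1 => (a : ℤ)).union
      ((hfin.insert 0).image fun a : ℕ => fun _ : Fin 1 => -(a : ℤ))).subset fun q hq => ?_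
    have hmem : (q 0).natAbs ∈ insert 0 {q : ℕ | 0 < q ∧ nearestIntDist (fun i => (q : ℝ) * y i -
        (0 : EuclideanSpace ℝ (Fin n)) i) < (q : ℝ) ^ (-τ₁)} := by
      rcases Nat.eq_zero_or_pos (q 0).natAbs with h0 | h0
      · exact Or.inl h0
      · refine Or.inr ⟨h0, ?_⟩
        have hnorm : ‖fun j => (q j : ℝ)‖ = ((q 0).natAbs : ℝ) := by
          rw [Nat.cast_natAbs, Int.cast_abs, ← Real.norm_eq_abs]
          refine le_antisymm ((pi_norm_le_iff_of_nonneg (norm_nonneg _)).2 fun j => ?_)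
            (norm_le_pi_norm (fun j => (q j : ℝ)) 0)
          rw [Subsingleton.elim j 0]
        have hq' : nearestIntDist ((Matrix.of fun (i : Fin n) (_ : Fin 1) => y i) *ᵥ
          fun j => (q j : ℝ)) < ‖fun j => (q j : ℝ)‖ ^ (-τ₁) := hq
        rw [hnorm] at hq'
        refine (nearestIntDist_lt_of_forall (by positivity) (fun i =>
          (q 0).sign * round ((q 0 : ℝ) * y i)) fun i => ?_)
        refine lt_of_le_of_lt ?_ hq'
        refine le_trans (le_of_eq ?_) (abs_sub_round_le_nearestIntDist _ i)
        have hs : ((q 0).natAbs : ℝ) = (q 0).sign * (q 0 : ℝ) := by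
          rw [Nat.cast_natAbs, ← Int.sign_mul_self_eq_abs]; push_cast; rfl
        have hs1 : |((q 0).sign : ℝ)| = 1 := by
          rw [← Int.cast_abs, Int.abs_sign_of_ne_zero (by omega)]; simp
        have e1 : ((Matrix.of fun (i : Fin n) (_ : Fin 1) => y i) *ᵥ fun j => (q j : ℝ)) i =
            (q 0 : ℝ) * y i := by
          simp [Matrix.mulVec, dotProduct, mul_comm]
        rw [e1, hs]
        simp only [PiLp.zero_apply, sub_zero]
        push_cast
        rw [mul_assoc, ← mul_sub, abs_mul, hs1, one_mul]
    rcases le_total 0 (q 0) with h | h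
    · refine Or.inl ⟨_, hmem, ?_⟩
      ext j; rw [Subsingleton.elim j 0]; simp only; omega
    · refine Or.inr ⟨_, hmem, ?_⟩
      ext j; rw [Subsingleton.elim j 0]; simp only; omega
  -- apply the transference with `δ = c₁ N^{-τ₁}` and first target `2 R N`, so that `q` lies
  -- between `R N` and `3 R N`; `ε` is small enough for `R δ` to beat `(3 R N)^{-τ}`
  set c₁ : ℝ := min c 1 with hc₁
  have hc₁0 : 0 < c₁ := lt_min hc one_pos
  set C : ℝ := 2 * (7 * (2 / c₁) ^ n + 1) with hC
  have hC0 : 0 < C := by positivity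
  have hexp : n * ε - τ₁ < -(τ * (1 + n * ε)) := by
    have h1 : n * ε = (1 / n - τ) / 2 := by rw [hε]; field_simp
    have h2 : τ < 1 := hτ.trans_le (by rw [div_le_one hn0]; exact hn')
    have h3 : 0 < n * ε := by positivity
    rw [hτ₁]
    nlinarith
  have hev : ∀ᶠ N : ℕ in Filter.atTop,
      (N : ℝ) ^ (-(τ₁ - n * ε - τ * (1 + n * ε))) < (3 * C) ^ (-τ) / (C * c₁) :=
    ((tendsto_rpow_neg_atTop (by linarith)).comp tendsto_natCast_atTop_atTop).eventually
      (gt_mem_nhds (by positivity))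
  obtain ⟨N₀, hN₀⟩ := Filter.eventually_atTop.1 hev
  refine Set.infinite_of_forall_exists_gt fun a => ?_
  set N : ℕ := max N₀ (a + 1) with hNdef
  have hN := hN₀ N (le_max_left _ _)
  have haN : a + 1 ≤ N := le_max_right _ _
  have hN1 : (1 : ℝ) ≤ N := by exact_mod_cast (by omega : 1 ≤ N)
  have hN0 : (0 : ℝ) < N := by linarith
  set δ : ℝ := c₁ * (N : ℝ) ^ (-τ₁) with hδ
  have hδ0 : 0 < δ := by positivity
  have hNτ : (N : ℝ) ^ (-τ₁) ≤ 1 := Real.rpow_le_one_of_one_le_of_nonpos hN1 (by linarith)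
  have hδ1 : δ ≤ 1 := by
    rw [hδ]; exact mul_le_one₀ (min_le_right _ _) (by positivity) hNτ
  have hno : ∀ (q : ℤ) (p : Fin n → ℤ), (q ≠ 0 ∨ p ≠ 0) → |(q : ℝ)| < N →
      ∃ i, δ ≤ |q * y i - p i| := by
    intro q p hqp hqN
    by_cases hq : q = 0
    · have hp : p ≠ 0 := hqp.resolve_left (by simp [hq])
      obtain ⟨i, hi⟩ := Function.ne_iff.1 hp
      refine ⟨i, hδ1.trans ?_⟩
      rw [hq]
      simp only [Int.cast_zero, zero_mul, zero_sub, abs_neg]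
      exact_mod_cast Int.one_le_abs hi
    · have hq1 : (fun _ : Fin 1 => q) ≠ 0 := Function.ne_iff.2 ⟨0, hq⟩
      have h1 := hcy _ hq1
      have hnorm : ‖fun _ : Fin 1 => (q : ℝ)‖ = |(q : ℝ)| := by
        rw [pi_norm_const, Real.norm_eq_abs]
      have hqpos : 0 < |(q : ℝ)| := by positivity
      rw [hnorm] at h1
      have h2 : δ ≤ c * |(q : ℝ)| ^ (-τ₁) :=
        mul_le_mul (min_le_left _ _)
          (Real.rpow_le_rpow_of_nonpos hqpos hqN.le (by linarith)) (by positivity) hc.le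
      obtain ⟨i, hi⟩ := exists_le_abs_sub_round hδ0 (h2.trans h1)
      refine ⟨i, hi.trans ((round_le _ (p i)).trans (le_of_eq ?_))⟩
      congr 2
      simp [Matrix.mulVec, dotProduct, mul_comm]
  set R : ℝ := 2 * (7 * (2 / δ) ^ Fintype.card (Fin n) / N + 1) with hR
  have hR2 : 2 ≤ R := by
    rw [hR]
    have : 0 ≤ 7 * (2 / δ) ^ Fintype.card (Fin n) / N := by positivity
    linarith
  have hRC : R ≤ C * (N : ℝ) ^ (n * ε) := by
    have h1 : (2 / δ) ^ n / N = (2 / c₁) ^ n * (N : ℝ) ^ (n * ε) := by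
      have e1 : (N : ℝ) ^ (n * ε) = ((N : ℝ) ^ τ₁) ^ n / N := by
        rw [← Real.rpow_mul_natCast hN0.le, ← Real.rpow_sub_one hN0.ne']
        congr 1
        rw [hτ₁]; field_simp; ring
      rw [e1, hδ, Real.rpow_neg hN0.le, mul_div_assoc', ← mul_pow]
      congr 2
      field_simp
    have h2 : 1 ≤ (N : ℝ) ^ (n * ε) := Real.one_le_rpow hN1 (by positivity)
    rw [hR, hC, Fintype.card_fin, mul_div_assoc, h1]
    nlinarith
  obtain ⟨q, p, hq, hp⟩ := exists_inhomogeneous_approx (fun i => y i) hN1 hδ0 hδ1 hno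
    (2 * R * N) fun i => θ i
  rw [← hR] at hq hp
  rw [abs_le] at hq
  have hRN : N ≤ R * N := le_mul_of_one_le_left hN0.le (by linarith)
  have hqN : (N : ℝ) ≤ q := by linarith
  have hq3 : (q : ℝ) ≤ 3 * R * N := by linarith
  lift q to ℕ using (by exact_mod_cast hN0.le.trans hqN)
  have hqN' : N ≤ q := by exact_mod_cast hqN
  rw [Int.cast_natCast] at hq3
  refine ⟨q, ⟨by omega, ?_⟩, by omega⟩
  have hq0 : (0 : ℝ) < q := by exact_mod_cast (by omega : 0 < q)
  have hle : nearestIntDist (fun i => (q : ℝ) * y i - θ i) ≤ R * δ := by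
    refine nearestIntDist_le_of_forall (by positivity) p fun i => ?_
    have := hp i
    rw [abs_sub_comm] at this
    rw [Int.cast_natCast] at this
    convert this using 2; ring
  refine hle.trans_lt ?_
  calc R * δ ≤ C * (N : ℝ) ^ (n * ε) * (c₁ * (N : ℝ) ^ (-τ₁)) := by rw [hδ]; gcongr
    _ = C * c₁ * ((N : ℝ) ^ (-(τ₁ - n * ε - τ * (1 + n * ε))) *
          (N : ℝ) ^ (-(τ * (1 + n * ε)))) := by
        rw [← Real.rpow_add hN0, mul_mul_mul_comm, ← Real.rpow_add hN0]; congr 2; ring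
    _ < C * c₁ * ((3 * C) ^ (-τ) / (C * c₁) * (N : ℝ) ^ (-(τ * (1 + n * ε)))) := by gcongr
    _ = (3 * C * (N : ℝ) ^ (1 + n * ε)) ^ (-τ) := by
        rw [Real.mul_rpow (x := 3 * C) (by positivity) (by positivity), ← Real.rpow_mul hN0.le]
        have : (N : ℝ) ^ (-(τ * (1 + n * ε))) = N ^ ((1 + n * ε) * -τ) := by congr 1; ring
        rw [this]; field_simp
    _ ≤ (q : ℝ) ^ (-τ) := by
        refine Real.rpow_le_rpow_of_nonpos hq0 (hq3.trans ?_) (by linarith)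
        rw [Real.rpow_add hN0, Real.rpow_one]
        nlinarith

/-! ### Points on affine subspaces close to rational hyperplanes -/

/-- An integral affine form which is small at `y` produces good simultaneous approximations of `y`:
by the pigeonhole principle there are two indices for which the integral value of the form at
the coordinatewise floors agrees and all fractional parts but the `j`-th are close; the vanishing
of the form on the difference then controls the `j`-th coordinate. -/
theorem exists_nearestIntDist_le_of_small_form {ι : Type*} [Fintype ι] (y : ι → ℝ) (j : ι)
    (Q : ι → ℤ) (p₀ : ℤ) {K G T X : ℕ} (hG : 0 < G) (hX : 0 < X) (hQj : |Q j| = X)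
    (hQ : ∀ i, |Q i| ≤ K * X) {η : ℝ} (hη : |p₀ + ∑ i, Q i * y i| ≤ η) (hTη : T * η ≤ X)
    (hT : (2 * ((Fintype.card ι * K + 1) * X) + 1) * G ^ (Fintype.card ι - 1) < T) :
    ∃ q : ℕ, 0 < q ∧ q < T ∧
      nearestIntDist (fun i => (q : ℝ) * y i) ≤ T * η / X + Fintype.card ι * K / G := by
  classical
  have hG' : (0 : ℝ) < G := by exact_mod_cast hG
  have hX' : (0 : ℝ) < X := by exact_mod_cast hX
  have hη0 : 0 ≤ η := (abs_nonneg _).trans hη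
  have hK : 1 ≤ K := by
    have h1 := hQ j
    rw [hQj] at h1
    have h2 : X ≤ K * X := by exact_mod_cast h1
    by_contra! h0
    interval_cases K
    omega
  have hK' : (1 : ℝ) ≤ K := by exact_mod_cast hK
  have hQr : ∀ i, |(Q i : ℝ)| ≤ K * X := fun i => by
    rw [← Int.cast_abs]; exact_mod_cast hQ i
  set Z : ℕ := (Fintype.card ι * K + 1) * X with hZ
  let z : ℕ → ℤ := fun q => q * p₀ + ∑ i, Q i * ⌊(q : ℝ) * y i⌋
  let f : ℕ → ℤ × ({i // i ≠ j} → ℕ) := fun q => (z q, fun i => ⌊G * Int.fract ((q : ℝ) * y i)⌋₊)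
  let B : Finset (ℤ × ({i // i ≠ j} → ℕ)) :=
    Finset.Icc (-(Z : ℤ)) Z ×ˢ Fintype.piFinset fun _ => Finset.range G
  have hBcard : B.card = (2 * Z + 1) * G ^ (Fintype.card ι - 1) := by
    rw [Finset.card_product, Fintype.card_piFinset, Finset.prod_const, Int.card_Icc,
      Finset.card_range, Finset.card_univ]
    congr 1
    · omega
    · congr 1
      rw [Fintype.card_subtype_compl, Fintype.card_subtype_eq]
  have hmaps : Set.MapsTo f (Finset.range T) B := by
    intro q hq
    have hq' : (q : ℝ) ≤ T := by
      exact_mod_cast (Finset.mem_range.1 (Finset.mem_coe.1 hq)).le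
    refine Finset.mem_coe.2 (Finset.mem_product.2 ⟨?_, Fintype.mem_piFinset.2 fun i =>
      Finset.mem_range.2 ?_⟩)
    · rw [Finset.mem_Icc, ← abs_le]
      have h1 : (z q : ℝ) = q * (p₀ + ∑ i, Q i * y i) - ∑ i, Q i * Int.fract ((q : ℝ) * y i) := by
        simp only [z, Int.fract, mul_sub, Finset.sum_sub_distrib, mul_add, Finset.mul_sum]
        push_cast
        have : ∑ i, (q : ℝ) * (Q i * y i) = ∑ i, (Q i : ℝ) * (q * y i) :=
          Finset.sum_congr rfl fun i _ => by ring
        rw [this]; ring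
      have h2 : |(q : ℝ) * (p₀ + ∑ i, Q i * y i)| ≤ X := by
        rw [abs_mul, Nat.abs_cast]
        exact (mul_le_mul hq' hη (abs_nonneg _) (by positivity)).trans hTη
      have h3 : |∑ i, (Q i : ℝ) * Int.fract ((q : ℝ) * y i)| ≤ Fintype.card ι * (K * X) := by
        refine (Finset.abs_sum_le_sum_abs _ _).trans ?_
        rw [← nsmul_eq_mul, ← Finset.card_univ]
        refine Finset.sum_le_card_nsmul _ _ _ fun i _ => ?_
        rw [abs_mul, abs_of_nonneg (Int.fract_nonneg ((q : ℝ) * y i))]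
        exact (mul_le_of_le_one_right (abs_nonneg _) (Int.fract_lt_one _).le).trans (hQr i)
      have h4 : |(z q : ℝ)| ≤ Z := by
        rw [h1]
        refine (abs_sub _ _).trans ?_
        rw [hZ]; push_cast; linarith
      exact_mod_cast h4
    · rw [Nat.floor_lt (by have := Int.fract_nonneg ((q : ℝ) * y i); positivity)]
      exact mul_lt_of_lt_one_right hG' (Int.fract_lt_one _)
  have hcard : B.card < (Finset.range T).card := by rw [hBcard, Finset.card_range]; exact hT
  obtain ⟨a, b, hab, hbT, hfab⟩ : ∃ a b, a < b ∧ b < T ∧ f a = f b := by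
    obtain ⟨a, ha, b, hb, hne, h⟩ := Finset.exists_ne_map_eq_of_card_lt_of_maps_to hcard hmaps
    rw [Finset.mem_range] at ha hb
    rcases lt_or_gt_of_ne hne with h' | h'
    · exact ⟨a, b, h', hb, h⟩
    · exact ⟨b, a, h', ha, h.symm⟩
  refine ⟨b - a, by omega, by omega, ?_⟩
  set p : ι → ℤ := fun i => ⌊(b : ℝ) * y i⌋ - ⌊(a : ℝ) * y i⌋ with hp
  set q : ℝ := ((b - a : ℕ) : ℝ) with hq
  have hqab : q = b - a := by rw [hq, Nat.cast_sub hab.le]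
  have hq0 : 0 ≤ q := Nat.cast_nonneg _
  have hqT : q ≤ T := by rw [hq]; exact_mod_cast (by omega : b - a ≤ T)
  have hfr : ∀ i, q * y i - p i = Int.fract ((b : ℝ) * y i) - Int.fract ((a : ℝ) * y i) := by
    intro i
    simp only [hp, hqab, Int.fract]; push_cast; ring
  have hi : ∀ i, i ≠ j → |q * y i - p i| ≤ 1 / G := by
    intro i hij
    have h1 : ⌊G * Int.fract ((a : ℝ) * y i)⌋₊ = ⌊G * Int.fract ((b : ℝ) * y i)⌋₊ :=
      congrFun (congrArg Prod.snd hfab) ⟨i, hij⟩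
    have ha0 : 0 ≤ G * Int.fract ((a : ℝ) * y i) :=
      mul_nonneg hG'.le (Int.fract_nonneg _)
    have hb0 : 0 ≤ G * Int.fract ((b : ℝ) * y i) :=
      mul_nonneg hG'.le (Int.fract_nonneg _)
    have a1 := Nat.floor_le ha0
    have a2 := Nat.lt_floor_add_one (G * Int.fract ((a : ℝ) * y i))
    have b1 := Nat.floor_le hb0
    have b2 := Nat.lt_floor_add_one (G * Int.fract ((b : ℝ) * y i))
    rw [h1] at a1 a2
    rw [hfr, le_div_iff₀ hG', ← abs_of_pos hG', ← abs_mul, abs_le]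
    constructor <;> nlinarith
  have hz : q * p₀ + ∑ i, (Q i : ℝ) * p i = 0 := by
    have h1 : z a = z b := congrArg Prod.fst hfab
    have h2 : ((z b - z a : ℤ) : ℝ) = 0 := by rw [h1]; simp
    rw [← h2]
    simp only [z, hp, hqab]
    push_cast
    simp only [mul_sub, Finset.sum_sub_distrib]
    ring
  have hsum : ∑ i, (Q i : ℝ) * (q * y i - p i) = q * (p₀ + ∑ i, Q i * y i) := by
    have : ∑ i, (Q i : ℝ) * (q * y i - p i) =
        q * ∑ i, (Q i * y i : ℝ) - ∑ i, (Q i * p i : ℝ) := by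
      rw [Finset.mul_sum, ← Finset.sum_sub_distrib]
      exact Finset.sum_congr rfl fun i _ => by ring
    rw [this]; linarith
  have hj : |q * y j - p j| ≤ T * η / X + Fintype.card ι * K / G := by
    rw [← Finset.add_sum_erase _ _ (Finset.mem_univ j)] at hsum
    have h1 : (Q j : ℝ) * (q * y j - p j) = q * (p₀ + ∑ i, Q i * y i) -
        ∑ i ∈ Finset.univ.erase j, (Q i : ℝ) * (q * y i - p i) := by linarith
    have h2 : |∑ i ∈ Finset.univ.erase j, (Q i : ℝ) * (q * y i - p i)| ≤
        Fintype.card ι * (K * X * (1 / G)) := by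
      refine (Finset.abs_sum_le_sum_abs _ _).trans ?_
      refine (Finset.sum_le_card_nsmul _ _ (K * X * (1 / G) : ℝ) fun i hi' => ?_).trans ?_
      · rw [abs_mul]
        exact mul_le_mul (hQr i) (hi i (Finset.ne_of_mem_erase hi')) (abs_nonneg _)
          (by positivity)
      · rw [nsmul_eq_mul]
        refine mul_le_mul_of_nonneg_right ?_ (by positivity)
        exact_mod_cast (Finset.card_erase_le).trans_eq Finset.card_univ
    have h3 : |q * (p₀ + ∑ i, Q i * y i)| ≤ T * η := by
      rw [abs_mul, abs_of_nonneg hq0]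
      exact mul_le_mul hqT hη (abs_nonneg _) (by positivity)
    have h4 : X * |q * y j - p j| ≤ T * η + Fintype.card ι * (K * X * (1 / G)) := by
      have : (X : ℝ) = |(Q j : ℝ)| := by rw [← Int.cast_abs, hQj]; simp
      rw [this, ← abs_mul, h1, ← this]
      exact (abs_sub _ _).trans (add_le_add h3 h2)
    have h5 : T * η / X + Fintype.card ι * K / G =
        (T * η + Fintype.card ι * (K * X * (1 / G))) / X := by field_simp
    rw [h5, le_div_iff₀ hX', mul_comm]
    exact h4
  refine nearestIntDist_le_of_forall (by positivity) p fun i => ?_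
  by_cases hij : i = j
  · rw [hij]; exact hj
  · refine (hi i hij).trans ?_
    have h1 : (1 : ℝ) / G ≤ Fintype.card ι * K / G := by
      have : (1 : ℝ) ≤ Fintype.card ι := by
        exact_mod_cast Fintype.card_pos_iff.2 ⟨j⟩
      gcongr
      nlinarith
    have h2 : 0 ≤ T * η / X := by positivity
    linarith

/-- Khintchine transference: if integral affine forms of height `X` take values `O(X^{-w})` at `y`
for arbitrarily large `X`, then `y` is simultaneously `q^{-τ}`-approximable for each
`τ < w / (n + (n - 1) w)`. -/
theorem mem_powerApproximableSet_zero_of_small_forms {n : ℕ} (hn : 1 ≤ n)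
    (y : EuclideanSpace ℝ (Fin n)) {w C τ : ℝ} (K : ℕ) (hw : 0 < w) (hC : 0 < C) (hτ0 : 0 ≤ τ)
    (hτ : τ * (n + (n - 1) * w) < w)
    (hform : ∃ᶠ X : ℕ in Filter.atTop, ∃ (j : Fin n) (Q : Fin n → ℤ) (p₀ : ℤ), |Q j| = X ∧
      (∀ i, |Q i| ≤ K * X) ∧ |p₀ + ∑ i, Q i * y i| ≤ C * (X : ℝ) ^ (-w)) :
    y ∈ powerApproximableSet τ 0 := by
  have hn' : (1 : ℝ) ≤ n := by exact_mod_cast hn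
  have hn0 : (0 : ℝ) < n := by linarith
  -- with accuracy `X^{-b}`, the pigeonhole needs about `X^a` indices; the choice of `b` balances
  -- the two error terms `X^{a-1-w}` and `X^{-b}`
  set b : ℝ := w / n with hb
  have hb0 : 0 < b := by positivity
  have hbn : b * n = w := by rw [hb]; field_simp
  set a : ℝ := 1 + b * (n - 1) with ha
  have haτ : a * τ < b := by
    have h1 : a * n = n + (n - 1) * w := by rw [ha, ← hbn]; ring
    have h2 : τ * (a * n) < b * n := by rw [h1, hbn]; exact hτ
    have h3 : (a * τ) * n < b * n := by linarith
    exact lt_of_mul_lt_mul_right h3 hn0.le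
  set C₁ : ℝ := (2 * (n * K + 1) + 2) * 2 ^ (n - 1) with hC₁
  have hC₁0 : 0 < C₁ := by positivity
  set C₂ : ℝ := C₁ * C + n * K with hC₂
  have hC₂0 : 0 < C₂ := by positivity
  have hlim : ∀ e : ℝ, 0 < e → ∀ r : ℝ, 0 < r → ∀ᶠ X : ℕ in Filter.atTop, (X : ℝ) ^ (-e) < r :=
    fun e he r hr => ((tendsto_rpow_neg_atTop he).comp tendsto_natCast_atTop_atTop).eventually
      (gt_mem_nhds hr)
  -- for suitable large `X` there is a solution `q` with error `O(X^{-b})`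
  have hsol : ∃ᶠ X : ℕ in Filter.atTop, ∃ q : ℕ, (0 < q ∧
      nearestIntDist (fun i => (q : ℝ) * y i - (0 : EuclideanSpace ℝ (Fin n)) i) <
        (q : ℝ) ^ (-τ)) ∧ nearestIntDist (fun i => (q : ℝ) * y i) ≤ C₂ * (X : ℝ) ^ (-b) := by
    refine ((hform.and_eventually (hlim b hb0 (1 / (C₁ * C)) (by positivity))).and_eventually
      ((hlim (b - a * τ) (by linarith) (C₁ ^ (-τ) / C₂) (by positivity)).and
        (Filter.eventually_ge_atTop 1))).mono ?_
    rintro X ⟨⟨⟨j, Q, p₀, hQj, hQ, hη⟩, hX1⟩, hX2, hX3⟩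
    have hX : (1 : ℝ) ≤ X := by exact_mod_cast hX3
    have hX0 : (0 : ℝ) < X := by linarith
    set x : ℝ := (X : ℝ) ^ b with hx
    have hx1 : 1 ≤ x := Real.one_le_rpow hX hb0.le
    have hx0 : 0 < x := by linarith
    set G : ℕ := ⌈x⌉₊ with hG
    have hxG : x ≤ G := Nat.le_ceil x
    have hGx : (G : ℝ) ≤ 2 * x := by
      have := Nat.ceil_lt_add_one hx0.le; linarith
    have hG0 : 0 < G := Nat.ceil_pos.2 hx0
    have hG1 : (1 : ℝ) ≤ G := by exact_mod_cast hG0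
    set T : ℕ := (2 * ((n * K + 1) * X) + 1) * G ^ (n - 1) + 1 with hT
    have hTX : (T : ℝ) ≤ C₁ * (X : ℝ) ^ a := by
      have h1 : (X : ℝ) ^ a = X * x ^ (n - 1) := by
        rw [hx, ← Real.rpow_mul_natCast hX0.le, ha, Real.rpow_add hX0, Real.rpow_one,
          Nat.cast_sub hn, Nat.cast_one]
      have h2 : (1 : ℝ) ≤ G ^ (n - 1) := one_le_pow₀ hG1
      have h3 : (G : ℝ) ^ (n - 1) ≤ 2 ^ (n - 1) * x ^ (n - 1) := by
        rw [← mul_pow]; gcongr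
      have h4 : (T : ℝ) = (2 * ((n * K + 1) * X) + 1) * G ^ (n - 1) + 1 := by
        rw [hT]; push_cast; ring
      calc (T : ℝ) ≤ (2 * ((n * K + 1) * X) + 1) * G ^ (n - 1) + G ^ (n - 1) := by
            rw [h4]; linarith
        _ = (2 * ((n * K + 1) * X) + 2) * G ^ (n - 1) := by ring
        _ ≤ ((2 * (n * K + 1) + 2) * X) * (2 ^ (n - 1) * x ^ (n - 1)) := by
            refine mul_le_mul ?_ h3 (by positivity) (by positivity)
            nlinarith
        _ = _ := by rw [h1, hC₁]; ring
    have hTη : T * (C * (X : ℝ) ^ (-w)) ≤ X * (C₁ * C * (X : ℝ) ^ (-b)) := by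
      calc T * (C * (X : ℝ) ^ (-w)) ≤ C₁ * (X : ℝ) ^ a * (C * (X : ℝ) ^ (-w)) := by gcongr
        _ = C₁ * C * ((X : ℝ) ^ a * (X : ℝ) ^ (-w)) := by ring
        _ = C₁ * C * ((X : ℝ) * (X : ℝ) ^ (-b)) := by
            congr 1
            rw [← Real.rpow_add hX0]
            nth_rewrite 2 [← Real.rpow_one (X : ℝ)]
            rw [← Real.rpow_add hX0, ha, ← hbn]
            congr 1; ring
        _ = _ := by ring
    have hTη' : T * (C * (X : ℝ) ^ (-w)) ≤ X := by
      refine hTη.trans (mul_le_of_le_one_right hX0.le ?_)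
      rw [lt_div_iff₀ (by positivity)] at hX1
      linarith
    obtain ⟨q, hq0, hqT, hq⟩ := exists_nearestIntDist_le_of_small_form (fun i => y i) j Q p₀
      (K := K) (T := T) hG0 hX3 hQj hQ hη hTη' (by rw [Fintype.card_fin, hT]; omega)
    have hq2 : nearestIntDist (fun i => (q : ℝ) * y i) ≤ C₂ * (X : ℝ) ^ (-b) := by
      refine hq.trans ?_
      rw [hC₂, add_mul, Fintype.card_fin]
      refine add_le_add ?_ ?_
      · rw [div_le_iff₀ hX0]; linarith
      · rw [Real.rpow_neg hX0.le, ← div_eq_mul_inv]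
        gcongr
    refine ⟨q, ⟨hq0, ?_⟩, hq2⟩
    simp only [PiLp.zero_apply, sub_zero]
    refine hq2.trans_lt ?_
    have hq0' : (0 : ℝ) < q := by exact_mod_cast hq0
    have hqT' : (q : ℝ) ≤ C₁ * (X : ℝ) ^ a := by
      have : (q : ℝ) ≤ T := by exact_mod_cast hqT.le
      exact this.trans hTX
    calc C₂ * (X : ℝ) ^ (-b) = C₂ * ((X : ℝ) ^ (-(b - a * τ)) * (X : ℝ) ^ (a * -τ)) := by
          rw [← Real.rpow_add hX0]; congr 2; ring
      _ < C₂ * (C₁ ^ (-τ) / C₂ * (X : ℝ) ^ (a * -τ)) := by gcongr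
      _ = (C₁ * (X : ℝ) ^ a) ^ (-τ) := by
          rw [Real.mul_rpow hC₁0.le (by positivity), ← Real.rpow_mul hX0.le]; field_simp
      _ ≤ _ := Real.rpow_le_rpow_of_nonpos hq0' hqT' (by linarith)
  -- the solutions found cannot all belong to a finite set, since their errors tend to `0`
  by_contra hfin
  have hfin' : {q : ℕ | 0 < q ∧ nearestIntDist (fun i => (q : ℝ) * y i -
      (0 : EuclideanSpace ℝ (Fin n)) i) < (q : ℝ) ^ (-τ)}.Finite := Set.not_infinite.1 hfin
  have hev : ∀ᶠ X : ℕ in Filter.atTop, ∀ q ∈ {q : ℕ | 0 < q ∧ nearestIntDist (fun i =>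
      (q : ℝ) * y i - (0 : EuclideanSpace ℝ (Fin n)) i) < (q : ℝ) ^ (-τ)},
      C₂ * (X : ℝ) ^ (-b) < nearestIntDist (fun i => (q : ℝ) * y i) := by
    refine (Filter.eventually_all_finite hfin').2 fun q hq => ?_
    have hpos : 0 < nearestIntDist (fun i => (q : ℝ) * y i) := by
      -- if `q y` were integral, all multiples of `q` would be solutions
      refine lt_of_le_of_ne (nearestIntDist_nonneg _) fun h0 => ?_
      have hinj : Function.Injective fun k : ℕ => (k + 1) * q := by
        intro k l hkl
        have := Nat.eq_of_mul_eq_mul_right hq.1 hkl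
        omega
      refine Set.infinite_of_injective_forall_mem hinj (fun k => ?_) hfin'
      have hk0 : 0 < (k + 1) * q := Nat.mul_pos (Nat.succ_pos k) hq.1
      refine ⟨hk0, ?_⟩
      have h1 := nearestIntDist_natCast_mul_eq_zero h0.symm (k + 1)
      have h2 : (fun i => (((k + 1) * q : ℕ) : ℝ) * y i - (0 : EuclideanSpace ℝ (Fin n)) i) =
          fun i => ((k + 1 : ℕ) : ℝ) * (q * y i) := by
        ext i; simp [mul_assoc]
      rw [h2, h1]
      have : (0 : ℝ) < (((k + 1) * q : ℕ) : ℝ) := by exact_mod_cast hk0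
      positivity
    filter_upwards [hlim b hb0 _ (div_pos hpos hC₂0)] with X hX
    rwa [lt_div_iff₀ hC₂0, mul_comm] at hX
  obtain ⟨X, ⟨q, hq1, hq2⟩, hX⟩ := (hsol.and_eventually hev).exists
  exact absurd (hX q hq1) (not_lt.2 hq2)

/-- A good approximation `A h ≈ k` places the affine subspace close to a rational hyperplane. -/
theorem frequently_small_forms_affineParam {d m : ℕ} (A : Matrix (Fin (d + 1)) (Fin m) ℝ) {w : ℝ}
    (hm : 1 ≤ m) (hinf : {q : Fin m → ℤ |
      nearestIntDist (A *ᵥ fun j => (q j : ℝ)) < ‖fun j => (q j : ℝ)‖ ^ (-w)}.Infinite)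
    (x : Fin d → ℝ) :
    ∃ᶠ X : ℕ in Filter.atTop, ∃ (j : Fin (d + m)) (Q : Fin (d + m) → ℤ) (p₀ : ℤ), |Q j| = X ∧
      (∀ i, |Q i| ≤ (⌈∑ i, ∑ j, |A i j|⌉₊ + 1 : ℕ) * X) ∧
      |p₀ + ∑ i, Q i * affineParam A x i| ≤ (1 + ∑ i, |x i|) * (X : ℝ) ^ (-w) := by
  classical
  have : Nonempty (Fin m) := ⟨⟨0, hm⟩⟩
  refine Filter.frequently_atTop.2 fun X₀ => ?_
  obtain ⟨h, hh, hhX⟩ := hinf.exists_notMem_finite (finite_intVec_norm_le (κ := Fin m) (X₀ + 1))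
  have hhX' : (X₀ : ℝ) + 1 < ‖fun j => (h j : ℝ)‖ := not_le.1 hhX
  obtain ⟨j, -, hj⟩ := Finset.exists_max_image Finset.univ (fun j => |h j|) Finset.univ_nonempty
  set X : ℕ := (h j).natAbs with hX
  have hXj : |h j| = X := by rw [hX, Int.natCast_natAbs]
  have hnorm : ‖fun j => (h j : ℝ)‖ = X := by
    have hXr : (X : ℝ) = ‖(h j : ℝ)‖ := by
      rw [Real.norm_eq_abs, ← Int.cast_abs, hXj]; simp
    refine le_antisymm ((pi_norm_le_iff_of_nonneg (by positivity)).2 fun i => ?_) ?_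
    · rw [Real.norm_eq_abs, ← Int.cast_abs]
      have := hj i (Finset.mem_univ i)
      rw [hXj] at this
      exact_mod_cast this
    · rw [hXr]; exact norm_le_pi_norm (fun j => (h j : ℝ)) j
  have hh' : nearestIntDist (A *ᵥ fun j => (h j : ℝ)) < ‖fun j => (h j : ℝ)‖ ^ (-w) := hh
  rw [hnorm] at hh' hhX'
  have hX1 : 1 ≤ X := by
    have : (1 : ℝ) ≤ X := by have : (0 : ℝ) ≤ X₀ := Nat.cast_nonneg _; linarith
    exact_mod_cast this
  set k : Fin (d + 1) → ℤ := fun i => round ((A *ᵥ fun j => (h j : ℝ)) i) with hk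
  have herr : ∀ i, |(A *ᵥ fun j => (h j : ℝ)) i - k i| ≤ (X : ℝ) ^ (-w) := fun i =>
    (abs_sub_round_le_nearestIntDist _ i).trans hh'.le
  set S : ℝ := ∑ i, ∑ j, |A i j| with hS
  have hAh : ∀ i, |(A *ᵥ fun j => (h j : ℝ)) i| ≤ S * X := by
    intro i
    calc |∑ j, A i j * (h j : ℝ)| ≤ ∑ j, |A i j * h j| := Finset.abs_sum_le_sum_abs _ _
      _ ≤ ∑ j, |A i j| * X := by
          refine Finset.sum_le_sum fun j _ => ?_
          rw [abs_mul, ← hnorm]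
          exact mul_le_mul_of_nonneg_left (norm_le_pi_norm (fun j => (h j : ℝ)) j) (abs_nonneg _)
      _ = (∑ j, |A i j|) * X := (Finset.sum_mul _ _ _).symm
      _ ≤ S * X := by
          refine mul_le_mul_of_nonneg_right ?_ (Nat.cast_nonneg _)
          exact Finset.single_le_sum (f := fun i => ∑ j, |A i j|)
            (fun _ _ => Finset.sum_nonneg fun _ _ => abs_nonneg _) (Finset.mem_univ i)
  refine ⟨X, ?_, Fin.natAdd d j, Fin.append (fun i => -k i.succ) h, -k 0, ?_, fun i => ?_, ?_⟩
  · have : (X₀ : ℝ) ≤ X := by linarith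
    exact_mod_cast this
  · rw [Fin.append_right, hXj]
  · refine Fin.addCases (fun i => ?_) (fun i => ?_) i
    · rw [Fin.append_left, abs_neg]
      have h1 : |(k i.succ : ℝ)| ≤ (⌈S⌉₊ + 1 : ℕ) * X := by
        have e1 := abs_sub_round ((A *ᵥ fun j => (h j : ℝ)) i.succ)
        have e2 := hAh i.succ
        have e3 : S * X ≤ ⌈S⌉₊ * X := by gcongr; exact Nat.le_ceil S
        have e4 : (1 : ℝ) ≤ X := by exact_mod_cast hX1
        rw [abs_le] at e1 e2 ⊢
        push_cast
        simp only [hk]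
        constructor <;> linarith
      exact_mod_cast h1
    · rw [Fin.append_right]
      have e1 := hj i (Finset.mem_univ i)
      rw [hXj] at e1
      refine e1.trans ?_
      have : X ≤ (⌈S⌉₊ + 1) * X := Nat.le_mul_of_pos_left _ (Nat.succ_pos _)
      exact_mod_cast this
  · have h1 : ((-k 0 : ℤ) : ℝ) + ∑ i, ((Fin.append (fun i => -k i.succ) h i : ℤ) : ℝ) *
        affineParam A x i = ((A *ᵥ fun j => (h j : ℝ)) 0 - k 0) +
          ∑ i : Fin d, x i * ((A *ᵥ fun j => (h j : ℝ)) i.succ - k i.succ) := by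
      rw [Fin.sum_univ_add]
      simp only [Fin.append_left, Fin.append_right, affineParam_castAdd, affineParam_natAdd,
        Matrix.mulVec, dotProduct, mul_sub, mul_add, Finset.sum_sub_distrib,
        Finset.sum_add_distrib, Finset.mul_sum]
      rw [Finset.sum_comm (s := (Finset.univ : Finset (Fin m)))]
      push_cast
      have e1 : ∑ i : Fin d, -(k i.succ : ℝ) * x i = -∑ i : Fin d, x i * (k i.succ : ℝ) := by
        rw [← Finset.sum_neg_distrib]; exact Finset.sum_congr rfl fun i _ => by ring
      have e2 : ∑ j, (h j : ℝ) * A 0 j = ∑ j, A 0 j * (h j : ℝ) :=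
        Finset.sum_congr rfl fun i _ => by ring
      have e3 : ∑ i : Fin d, ∑ j, (h j : ℝ) * (x i * A i.succ j) =
          ∑ i : Fin d, ∑ j, x i * (A i.succ j * (h j : ℝ)) :=
        Finset.sum_congr rfl fun i _ => Finset.sum_congr rfl fun j _ => by ring
      rw [e1, e2, e3]; ring
    rw [h1, add_mul, one_mul]
    refine (abs_add_le _ _).trans (add_le_add (herr 0) ?_)
    rw [Finset.sum_mul]
    refine (Finset.abs_sum_le_sum_abs _ _).trans (Finset.sum_le_sum fun i _ => ?_)
    rw [abs_mul]
    exact mul_le_mul_of_nonneg_left (herr i.succ) (abs_nonneg _)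

/-! ### The exponent of the affine subspace -/

/-- An upper bound for the inhomogeneous exponent from almost everywhere
non-approximability. -/
theorem inhomogeneousExponent_le_of_forall {d m : ℕ} (A : Matrix (Fin (d + 1)) (Fin m) ℝ)
    (θ : EuclideanSpace ℝ (Fin (d + m))) {b : ℝ}
    (h : ∀ τ : ℝ, b < τ → volume (affineParam A ⁻¹' powerApproximableSet τ θ) = 0) :
    inhomogeneousExponent d (affineSubspaceOfMatrix A) θ ≤ b := by
  refine sSup_le ?_
  rintro _ ⟨τ, hτ, rfl⟩
  refine EReal.coe_le_coe_iff.2 ?_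
  by_contra! hc
  exact hτ.ne' ((inducedLebesgue_inter_eq_zero_iff A _).2 (h τ hc))

theorem le_inhomogeneousExponent {d m : ℕ} (A : Matrix (Fin (d + 1)) (Fin m) ℝ)
    (θ : EuclideanSpace ℝ (Fin (d + m))) {τ : ℝ}
    (h : volume (affineParam A ⁻¹' powerApproximableSet τ θ) ≠ 0) :
    (τ : EReal) ≤ inhomogeneousExponent d (affineSubspaceOfMatrix A) θ :=
  le_sSup (Set.mem_image_of_mem _
    (pos_iff_ne_zero.2 fun h0 => h ((inducedLebesgue_inter_eq_zero_iff A _).1 h0)))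

theorem inhomogeneousExponent_le_of_diophantineExponent {d m n : ℕ} (hd : 1 ≤ d) (hn : n = d + m)
    (A : Matrix (Fin (d + 1)) (Fin m) ℝ) (θ : EuclideanSpace ℝ (Fin (d + m))) :
    inhomogeneousExponent d (affineSubspaceOfMatrix A) θ ≤
      (1 / (d : EReal)) * (1 - (m : EReal) / max (n : EReal) (diophantineExponent A)) := by
  have hd0 : (0 : ℝ) < d := by exact_mod_cast hd
  set M : EReal := max (n : EReal) (diophantineExponent A) with hM
  have hnM : ((n : ℝ) : EReal) ≤ M := le_max_left _ _
  have hωM : diophantineExponent A ≤ M := le_max_right _ _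
  have hbot : M ≠ ⊥ := ne_bot_of_le_ne_bot (EReal.coe_ne_bot _) hnM
  by_cases htop : M = ⊤
  · rw [htop, EReal.div_top, sub_zero, mul_one]
    have : (1 / (d : EReal)) = ((1 / (d : ℝ) : ℝ) : EReal) := by
      rw [EReal.coe_div]; rfl
    rw [this]
    refine inhomogeneousExponent_le_of_forall A θ fun τ hτ => ?_
    refine volume_preimage_eq_zero_of_one_lt_mul A θ hd ?_
    rw [div_lt_iff₀ hd0] at hτ
    linarith
  · lift M to ℝ using ⟨htop, hbot⟩ with M'
    have hnM' : (n : ℝ) ≤ M' := EReal.coe_le_coe_iff.1 hnM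
    have hn' : (n : ℝ) = d + m := by rw [hn]; push_cast; rfl
    have hM0 : 0 < M' := by
      have : (0 : ℝ) ≤ m := Nat.cast_nonneg m
      linarith
    have : (1 / (d : EReal)) * (1 - (m : EReal) / (M' : EReal)) =
        ((1 / (d : ℝ) * (1 - m / M') : ℝ) : EReal) := by
      rw [EReal.coe_mul, EReal.coe_sub, EReal.coe_div, EReal.coe_div]; rfl
    rw [this]
    refine inhomogeneousExponent_le_of_forall A θ fun τ hτ => ?_
    rw [one_div, inv_mul_lt_iff₀ hd0] at hτ
    obtain ⟨w, hw, hMw⟩ := exists_gt_one_sub_div_lt hM0 hτ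
    exact volume_preimage_eq_zero_of_diophantineExponent_lt A θ hd
      (hωM.trans_lt (EReal.coe_lt_coe_iff.2 hMw)) (by linarith) hw

theorem inhomogeneousExponent_le_of_dualDiophantineExponent {d m n : ℕ} (hd : 1 ≤ d) (hm : 1 ≤ m)
    (hn : n = d + m) (A : Matrix (Fin (d + 1)) (Fin m) ℝ) (θ : EuclideanSpace ℝ (Fin (d + m))) :
    inhomogeneousExponent d (affineSubspaceOfMatrix A) θ ≤
      ((m : EReal) * dualDiophantineExponent A - (d : EReal)) / (n : EReal) := by
  have hm0 : (0 : ℝ) < m := by exact_mod_cast hm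
  have hn' : (n : ℝ) = d + m := by rw [hn]; push_cast; rfl
  have hd0 : (0 : ℝ) < d := by exact_mod_cast hd
  have hn0 : (0 : ℝ) < n := by linarith
  have hσ0 : 0 ≤ dualDiophantineExponent A := diophantineExponent_nonneg Aᵀ
  by_cases htop : dualDiophantineExponent A = ⊤
  · have h1 : (m : EReal) * ⊤ = ⊤ := EReal.coe_mul_top_of_pos hm0
    have h2 : (⊤ : EReal) - (d : EReal) = ⊤ := EReal.top_sub_coe (d : ℝ)
    have h3 : (⊤ : EReal) / (n : EReal) = ⊤ :=
      EReal.top_div_of_pos_ne_top (by exact_mod_cast hn0) (EReal.coe_ne_top (n : ℝ))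
    rw [htop, h1, h2, h3]
    exact le_top
  · have hbot : dualDiophantineExponent A ≠ ⊥ := ne_bot_of_le_ne_bot EReal.zero_ne_bot hσ0
    obtain ⟨σ, hσ⟩ : ∃ σ : ℝ, (σ : EReal) = dualDiophantineExponent A :=
      ⟨_, EReal.coe_toReal htop hbot⟩
    rw [← hσ] at hσ0 ⊢
    have hσ0' : 0 ≤ σ := by exact_mod_cast hσ0
    have : ((m : EReal) * (σ : EReal) - (d : EReal)) / (n : EReal) =
        (((m * σ - d) / n : ℝ) : EReal) := by
      rw [EReal.coe_div, EReal.coe_sub, EReal.coe_mul]; rfl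
    rw [this]
    refine inhomogeneousExponent_le_of_forall A θ fun τ hτ => ?_
    rw [div_lt_iff₀ hn0, hn'] at hτ
    -- room for an exponent strictly above `σ(A)`
    set w : ℝ := σ + (τ * (d + m) - (m * σ - d)) / (2 * m) with hw
    have hgap : 0 < (τ * (d + m) - (m * σ - d)) / (2 * m) := div_pos (by linarith) (by positivity)
    have hmw : m * w = m * σ + (τ * (d + m) - (m * σ - d)) / 2 := by rw [hw]; field_simp
    refine volume_preimage_eq_zero_of_dualDiophantineExponent_lt A θ (w := w) hd ?_
      (by linarith) ?_ (by linarith)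
    · rw [← hσ]; exact EReal.coe_lt_coe_iff.2 (by linarith)
    · by_contra! hc
      have : 0 ≤ m * σ := by positivity
      nlinarith

/-- If almost every point of the affine subspace is not very well approximable, transference gives
the lower bound `1 / n` for every shift. -/
theorem one_div_le_inhomogeneousExponent {d m : ℕ} (hd : 1 ≤ d)
    (A : Matrix (Fin (d + 1)) (Fin m) ℝ)
    (h0 : inhomogeneousExponent d (affineSubspaceOfMatrix A) 0 ≤ ((1 / (d + m : ℕ) : ℝ) : EReal))
    (θ : EuclideanSpace ℝ (Fin (d + m))) :
    ((1 / (d + m : ℕ) : ℝ) : EReal) ≤ inhomogeneousExponent d (affineSubspaceOfMatrix A) θ := by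
  have hnull : ∀ τ : ℝ, 1 / ((d + m : ℕ) : ℝ) < τ →
      volume (affineParam A ⁻¹' powerApproximableSet τ 0) = 0 := by
    intro τ hτ
    by_contra hne
    have h1 := (le_inhomogeneousExponent A 0 hne).trans h0
    exact absurd (EReal.coe_le_coe_iff.1 h1) (not_le.2 hτ)
  have hae : ∀ᵐ x : Fin d → ℝ, ∀ τ : ℝ, 1 / ((d + m : ℕ) : ℝ) < τ →
      affineParam A x ∉ powerApproximableSet τ 0 := by
    have h1 : ∀ᵐ x : Fin d → ℝ, ∀ k : ℕ, affineParam A x ∉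
        powerApproximableSet (1 / ((d + m : ℕ) : ℝ) + 1 / ((k : ℝ) + 1)) 0 := by
      refine ae_all_iff.2 fun k => ?_
      have h2 := hnull (1 / ((d + m : ℕ) : ℝ) + 1 / ((k : ℝ) + 1))
        (lt_add_of_pos_right _ Nat.one_div_pos_of_nat)
      exact measure_eq_zero_iff_ae_notMem.1 h2
    filter_upwards [h1] with x hx τ hτ hmem
    obtain ⟨k, hk⟩ := exists_nat_one_div_lt (sub_pos.2 hτ)
    exact hx k (powerApproximableSet_mono (by linarith) 0 hmem)
  refine EReal.ge_of_forall_gt_iff_ge.1 fun τ hτ => ?_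
  refine le_inhomogeneousExponent A θ ?_
  have hτ' : τ < 1 / ((d + m : ℕ) : ℝ) := EReal.coe_lt_coe_iff.1 hτ
  have hfull : ∀ᵐ x : Fin d → ℝ, x ∈ affineParam A ⁻¹' powerApproximableSet τ θ := by
    filter_upwards [hae] with x hx
    exact mem_powerApproximableSet_of_not_very_well_approximable (by omega) _ hx θ hτ'
  intro hz
  have h1 := measure_eq_zero_iff_ae_notMem.1 hz
  have h2 : ∀ᵐ _x : Fin d → ℝ, False := by
    filter_upwards [hfull, h1] with x hx hx'
    exact hx' hx
  exact h2.exists.elim fun _ h => h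

/-- If `ω(A) > n`, every point of the affine subspace is very well approximable, with a common
exponent above `1 / n`. -/
theorem one_div_lt_inhomogeneousExponent_zero {d m : ℕ} (hd : 1 ≤ d) (hm : 1 ≤ m)
    (A : Matrix (Fin (d + 1)) (Fin m) ℝ) (hω : ((d + m : ℕ) : EReal) < diophantineExponent A) :
    ((1 / (d + m : ℕ) : ℝ) : EReal) < inhomogeneousExponent d (affineSubspaceOfMatrix A) 0 := by
  obtain ⟨_, ⟨w, hw, rfl⟩, hnw⟩ := lt_sSup_iff.1 hω
  have hnw' : ((d + m : ℕ) : ℝ) < w := EReal.coe_lt_coe_iff.1 hnw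
  set n : ℕ := d + m with hn
  have hn1 : (1 : ℝ) ≤ n := by exact_mod_cast (by omega : 1 ≤ n)
  have hden : 0 < (n : ℝ) + (n - 1) * w := by nlinarith
  have hlt : 1 / (n : ℝ) < w / (n + (n - 1) * w) := by
    rw [div_lt_div_iff₀ (by linarith) hden]; linarith
  obtain ⟨τ, hτ1, hτ2⟩ := exists_between hlt
  refine lt_of_lt_of_le (EReal.coe_lt_coe_iff.2 hτ1) (le_inhomogeneousExponent A 0 ?_)
  have huniv : affineParam A ⁻¹' powerApproximableSet τ 0 = Set.univ := by
    refine Set.eq_univ_of_forall fun x => ?_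
    refine mem_powerApproximableSet_zero_of_small_forms (by omega) _ _ (by linarith)
      (add_pos_of_pos_of_nonneg one_pos (Finset.sum_nonneg fun _ _ => abs_nonneg _))
      (le_trans (by positivity) hτ1.le) ?_ (frequently_small_forms_affineParam A hm hw x)
    rwa [lt_div_iff₀ hden] at hτ2
  rw [huniv]
  exact NeZero.ne _

theorem theorem1p4 (d m n : ℕ) (hd : 1 ≤ d) (hm : 1 ≤ m) (hn : n = d + m)
    (A : Matrix (Fin (d + 1)) (Fin m) ℝ) :
    (∀ θ : EuclideanSpace ℝ (Fin (d + m)),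
      inhomogeneousExponent d (affineSubspaceOfMatrix A) θ ≤
        min ((1 / (d : EReal)) * (1 - (m : EReal) / max (n : EReal) (diophantineExponent A)))
          (((m : EReal) * dualDiophantineExponent A - (d : EReal)) / (n : EReal))) ∧
    (diophantineExponent A ≤ (n : EReal) ↔
      ∀ θ : EuclideanSpace ℝ (Fin (d + m)),
        inhomogeneousExponent d (affineSubspaceOfMatrix A) θ = 1 / (n : EReal)) := by
  have : NeZero m := ⟨by omega⟩
  have hone : (1 / (n : EReal)) = ((1 / (d + m : ℕ) : ℝ) : EReal) := by
    rw [EReal.coe_div, hn]; rfl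
  refine ⟨fun θ => le_min (inhomogeneousExponent_le_of_diophantineExponent hd hn A θ)
    (inhomogeneousExponent_le_of_dualDiophantineExponent hd hm hn A θ), fun hω => ?_, fun h => ?_⟩
  · have hupper : ∀ θ : EuclideanSpace ℝ (Fin (d + m)),
        inhomogeneousExponent d (affineSubspaceOfMatrix A) θ ≤
          ((1 / (d + m : ℕ) : ℝ) : EReal) := by
      intro θ
      refine (inhomogeneousExponent_le_of_diophantineExponent hd hn A θ).trans (le_of_eq ?_)
      rw [max_eq_left hω]
      have hval : (1 / (d : EReal)) * (1 - (m : EReal) / (n : EReal)) =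
          ((1 / (d : ℝ) * (1 - m / n) : ℝ) : EReal) := by
        rw [EReal.coe_mul, EReal.coe_sub, EReal.coe_div, EReal.coe_div]; rfl
      rw [hval, hn]
      have hd0 : (0 : ℝ) < d := by exact_mod_cast hd
      have hdm : ((d + m : ℕ) : ℝ) = d + m := by push_cast; rfl
      have hdm0 : (0 : ℝ) < d + m := by positivity
      rw [hdm]
      congr 1
      field_simp
      ring
    intro θ
    rw [hone]
    exact le_antisymm (hupper θ) (one_div_le_inhomogeneousExponent hd A (hupper 0) θ)
  · by_contra! hω
    rw [hn] at hω
    have h1 := one_div_lt_inhomogeneousExponent_zero hd hm A hω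
    rw [h 0, hone] at h1
    exact lt_irrefl _ h1
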